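/- Let $m\ge 1$, let $P\in\overline{\mathbb{Q}}[x_1,\dots,x_m]$ be a nonzero polynomial, and let $r=(r_1,\dots,r_m)$ be an $m$-tuple of positive integers with $\deg_{x_h}P\le r_h$ for all $1\le h\le m$. Let $\beta=(\beta_1,\dots,\beta_m)\in\overline{\mathbb{Q}}^m$ and let $0<\eta\le \frac12$ be a real number. Write $h(\alpha)$ for the absolute logarithmic Weil height of an algebraic number $\alpha$, and $$h(P)=\sum_{v\in M_K}\log\max_J|c_J|_v$$ for the absolute logarithmic height of $P=\sum_J c_Jx^J$, where $K$ is a number field containing all coefficients $c_J$, $M_K$ is its set of places, and $|\cdot|_v=\|\cdot\|_v^{[K_v:\mathbb{Q}_v]/[K:\mathbb{Q}]}$ with $\|\cdot\|_v$ extending the standard absolute value of $\mathbb{Q}_v$ (the value does not depend on $K$). For $I=(i_1,\dots,i_m)\in\mathbb{Z}_{\ge0}^m$ put $\partial_I=\frac{1}{i_1!\cdots i_m!}\left(\frac{\partial}{\partial x_1}\right)^{i_1}\cdots\left(\frac{\partial}{\partial x_m}\right)^{i_m}$, and define the index $$\operatorname{Ind}_{\beta,r}(P)=\min\left\{\frac{i_1}{r_1}+\dots+\frac{i_m}{r_m}\;:\;I\in\mathbb{Z}_{\ge0}^m,\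 \partial_IP(\beta)\neq0\right\}.$$ Suppose that $$\frac{r_{j+1}}{r_j}\le\eta^{2^{m-1}}\quad(1\le j\le m-1)\qquad\text{and}\qquad \eta^{2^{m-1}}\min_{1\le h\le m}\bigl(r_h\,h(\beta_h)\bigr)\ge h(P)+2mr_1.$$ Then $\operatorname{Ind}_{\beta,r}(P)\le 2m\eta$. -/

import Mathlib

namespace RothLemma

/-- The field of algebraic numbers. -/
abbrev QBar : Type := AlgebraicClosure ℚ

/-- The number field generated by the coefficients of a polynomial over the algebraic numbers. -/
noncomputable abbrev coeffField {m : ℕ} (P : MvPolynomial (Fin m) QBar) : IntermediateField ℚ QBar :=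
  IntermediateField.adjoin ℚ (P.coeffs : Set QBar)

theorem isIntegral_QBar (x : QBar) : IsIntegral ℚ x := by
  have h : @IsIntegral ℚ QBar _ _ (AlgebraicClosure.instAlgebra ℚ) x :=
    (AlgebraicClosure.isAlgebraic ℚ).isAlgebraic x |>.isIntegral
  convert h
  exact Subsingleton.elim _ _

instance coeffField_finiteDimensional {m : ℕ} (P : MvPolynomial (Fin m) QBar) :
    FiniteDimensional ℚ (coeffField P) :=
  IntermediateField.finiteDimensional_adjoin fun x _ => isIntegral_QBar x

instance coeffField_numberField {m : ℕ} (P : MvPolynomial (Fin m) QBar) :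
    NumberField (coeffField P) where
  to_charZero := inferInstance
  to_finiteDimensional := coeffField_finiteDimensional P

/-- The family of nonzero coefficients of `P`, as elements of the field they generate. -/
noncomputable def coeffFamily {m : ℕ} (P : MvPolynomial (Fin m) QBar) (s : P.support) : coeffField P :=
  ⟨P.coeff s, IntermediateField.subset_adjoin ℚ _
    (Finset.mem_coe.mpr
      (MvPolynomial.coeff_mem_coeffs s.1 (MvPolynomial.mem_support_iff.mp s.2)))⟩

/-- The absolute logarithmic height `h(P) = ∑_v log |P|_v` of a nonzero polynomial with algebraic
coefficients, where `|P|_v` is the maximum of the `v`-adic absolute values of the coefficients.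
`Height.logHeight` is the same sum for the absolute values that are not normalized by the degree
of the number field, so it is divided by that degree. -/
noncomputable def polyHeight {m : ℕ} (P : MvPolynomial (Fin m) QBar) : ℝ :=
  Height.logHeight (coeffFamily P) / (Module.finrank ℚ (coeffField P) : ℝ)

/-- The differential operator `∂_I = (1 / (i₁! ⋯ i_m!)) (∂/∂x₁)^{i₁} ⋯ (∂/∂x_m)^{i_m}`. -/
noncomputable def dividedDeriv {m : ℕ} (I : Fin m → ℕ) (P : MvPolynomial (Fin m) QBar) :
    MvPolynomial (Fin m) QBar :=
  ((∏ h, (Nat.factorial (I h) : QBar))⁻¹) •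
    (List.ofFn fun h : Fin m =>
      ((MvPolynomial.pderiv h).toLinearMap :
        Module.End QBar (MvPolynomial (Fin m) QBar)) ^ I h).prod P

/-- The index of `P` at `β` with respect to the weights `r`: the minimum of the numbers
`i₁/r₁ + ⋯ + i_m/r_m` over all multi-indices `I` with `∂_I P(β) ≠ 0`. -/
noncomputable def index {m : ℕ} (β : Fin m → QBar) (r : Fin m → ℕ)
    (P : MvPolynomial (Fin m) QBar) : ℝ :=
  sInf {t : ℝ | ∃ I : Fin m → ℕ, MvPolynomial.eval β (dividedDeriv I P) ≠ 0 ∧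
    t = ∑ h, (I h : ℝ) / (r h : ℝ)}

end RothLemma

/-!
The proof is by induction on the number of variables. Write `P` as a sum `∑ φⱼ ψⱼ` of `n` products
of polynomials `φⱼ` in the first variables and `ψⱼ` in the last one, with `n` minimal. Then the
`φⱼ` are linearly independent, and so are the `ψⱼ`, so that some generalized Wronskians `U` of the
`φⱼ` and `V` of the `ψⱼ` do not vanish. Their product `U V` is the determinant of an `n × n`
matrix of derivatives of `P`: its degrees and its height are at most about `n` times those of `P`.
The induction hypothesis bounds the index of `U`, and that of `V` is bounded because a polynomial
in one variable which vanishes at `b` to order `k` is divisible by `(X - b) ^ k`, so that `k h(b)`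
is at most about its height. Conversely, if `P` has index `θ`, then the entries of the `a`-th
column of the determinant have index at least about `θ - a / r` with `r` the last of the degrees
`r_h`, as `r` is much smaller than the others. So `∑ₐ max (θ - a / r) 0 ≤ n · O(η²)`, and this
forces `θ ≤ 2mη`, since the left hand side is at least about `n · min (θ / 2) (θ² / 4)`.

The index is the least weight of a monomial of the translate `P(X + β)`, which makes sense over
every field with a product formula; the theorem follows by descent to the number field generated
by `β` and the coefficients of `P`.
-/

namespace RothLemma

open Finset Height

/-! ### Heights of tuples -/

section LocalComparison

open AdmissibleAbsValues Function

lemma iSup_abv_pos {K ι : Type*} [Field K] [Finite ι] (v : AbsoluteValue K ℝ) {x : ι → K}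
    (hx : x ≠ 0) : 0 < ⨆ i, v (x i) := by
  obtain ⟨i, hi⟩ := ne_iff.mp hx
  exact (v.pos hi).trans_le (Finite.le_ciSup_of_le i le_rfl)

variable {K : Type*} [Field K] [AdmissibleAbsValues K] {ι ι' : Type*} [Finite ι']

lemma prod_archAbsVal_iSup_le {x : ι → K} {y : ι' → K} (hy : y ≠ 0) {C : ℝ} {n : ℕ}
    (h : ∀ v ∈ archAbsVal (K := K), (⨆ i, v (y i)) ≤ C * (⨆ i, v (x i)) ^ n) :
    (archAbsVal.map fun v : AbsoluteValue K ℝ ↦ ⨆ i, v (y i)).prod ≤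
      C ^ totalWeight K * (archAbsVal.map fun v : AbsoluteValue K ℝ ↦ ⨆ i, v (x i)).prod ^ n := by
  calc (archAbsVal.map fun v : AbsoluteValue K ℝ ↦ ⨆ i, v (y i)).prod
      ≤ (archAbsVal.map fun v : AbsoluteValue K ℝ ↦ C * (⨆ i, v (x i)) ^ n).prod :=
        Multiset.prod_map_le_prod_map₀ _ _ (fun v _ ↦ (iSup_abv_pos v hy).le) h
    _ = _ := by simp [Multiset.prod_map_mul, Multiset.prod_map_pow, totalWeight]

variable [Finite ι]

lemma hasFiniteMulSupport_iSup_abv {x : ι → K} (hx : x ≠ 0) :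
    (fun v : nonarchAbsVal (K := K) ↦ ⨆ i, v.val (x i)).HasFiniteMulSupport := by
  have hfinite := Set.finite_iUnion fun i : {j // x j ≠ 0} ↦ hasFiniteMulSupport (K := K) i.2
  refine hfinite.subset fun v hv ↦ ?_
  by_contra hunit
  simp only [Set.mem_iUnion, not_exists, mem_mulSupport, not_not] at hunit
  obtain ⟨i, hi⟩ := ne_iff.mp hx
  have : Nonempty ι := ⟨i⟩
  refine hv (le_antisymm (ciSup_le fun j ↦ ?_) (Finite.le_ciSup_of_le i (hunit ⟨i, hi⟩).ge))
  by_cases hj : x j = 0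
  · simp [hj]
  · exact (hunit ⟨j, hj⟩).le

lemma finprod_nonarchAbsVal_iSup_le {x : ι → K} {y : ι' → K} (hx : x ≠ 0) (hy : y ≠ 0) {n : ℕ}
    (h : ∀ v ∈ nonarchAbsVal (K := K), (⨆ i, v (y i)) ≤ (⨆ i, v (x i)) ^ n) :
    ∏ᶠ v : nonarchAbsVal (K := K), ⨆ i, v.val (y i) ≤
      (∏ᶠ v : nonarchAbsVal (K := K), ⨆ i, v.val (x i)) ^ n := by
  have hsupp := hasFiniteMulSupport_iSup_abv hx
  rw [finprod_pow hsupp]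
  exact finprod_le_finprod (hasFiniteMulSupport_iSup_abv hy)
    (fun v ↦ (iSup_abv_pos v.val hy).le)
    (hsupp.subset fun v hv h1 ↦ hv (by simp [h1])) (fun v ↦ h v.val v.2)

theorem mulHeight_le_of_local {x : ι → K} {y : ι' → K} (hx : x ≠ 0) (hy : y ≠ 0) {C : ℝ}
    (hC : 0 < C) (n : ℕ)
    (harch : ∀ v ∈ archAbsVal (K := K), (⨆ i, v (y i)) ≤ C * (⨆ i, v (x i)) ^ n)
    (hnonarch : ∀ v ∈ nonarchAbsVal (K := K), (⨆ i, v (y i)) ≤ (⨆ i, v (x i)) ^ n) :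
    mulHeight y ≤ C ^ totalWeight K * mulHeight x ^ n := by
  rw [mulHeight_eq hx, mulHeight_eq hy, mul_pow, ← mul_assoc]
  refine mul_le_mul (prod_archAbsVal_iSup_le hy harch)
    (finprod_nonarchAbsVal_iSup_le hx hy hnonarch)
    (finprod_nonneg fun v ↦ (iSup_abv_pos v.val hy).le) ?_
  have : 0 ≤ (archAbsVal.map fun v : AbsoluteValue K ℝ ↦ ⨆ i, v (x i)).prod :=
    Multiset.prod_map_nonneg fun v _ ↦ (iSup_abv_pos v hx).le
  positivity

theorem logHeight_le_of_local {x : ι → K} {y : ι' → K} (hx : x ≠ 0) (hy : y ≠ 0) {C : ℝ}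
    (hC : 0 < C) (n : ℕ)
    (harch : ∀ v ∈ archAbsVal (K := K), (⨆ i, v (y i)) ≤ C * (⨆ i, v (x i)) ^ n)
    (hnonarch : ∀ v ∈ nonarchAbsVal (K := K), (⨆ i, v (y i)) ≤ (⨆ i, v (x i)) ^ n) :
    logHeight y ≤ n * logHeight x + totalWeight K * Real.log C := by
  have hlog := Real.log_le_log (mulHeight_pos y) (mulHeight_le_of_local hx hy hC n harch hnonarch)
  rw [Real.log_mul (pow_pos hC _).ne' (pow_pos (mulHeight_pos x) _).ne', Real.log_pow,
    Real.log_pow, add_comm] at hlog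
  exact hlog

end LocalComparison

section Extension

open NumberField Function

variable {K L : Type*} [Field K] [NumberField K] [Field L] [NumberField L] [Algebra K L]

lemma prod_infinitePlace_pow_mult (f : AbsoluteValue K ℝ → ℝ) :
    ∏ v : InfinitePlace K, f v.val ^ v.mult = ∏ φ : K →+* ℂ, f (InfinitePlace.mk φ).val := by
  classical
  rw [← Finset.prod_fiberwise Finset.univ (InfinitePlace.mk (K := K))]
  refine Finset.prod_congr rfl fun w _ ↦ ?_
  rw [Finset.prod_congr rfl (g := fun _ ↦ f w.val), Finset.prod_const,
    InfinitePlace.card_filter_mk_eq]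
  intro φ hφ
  rw [(Finset.mem_filter.mp hφ).2]

lemma card_embeddings_extending (φ : K →+* ℂ) [DecidableEq (K →+* ℂ)] :
    #{ψ : L →+* ℂ | ψ.comp (algebraMap K L) = φ} = Module.finrank K L := by
  let _ := φ.toAlgebra
  have : FiniteDimensional K L := Module.Finite.of_restrictScalars_finite ℚ K L
  rw [← AlgHom.card K L ℂ, ← Fintype.card_subtype]
  exact Fintype.card_congr
    { toFun ψ := ⟨ψ.1, fun x ↦ congrFun (congrArg DFunLike.coe ψ.2) x⟩
      invFun ψ := ⟨ψ.toRingHom, RingHom.ext ψ.commutes⟩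
      left_inv _ := rfl
      right_inv _ := rfl }

lemma prod_infinitePlace_iSup_algebraMap {ι : Type*} (x : ι → K) :
    ∏ v : InfinitePlace L, (⨆ i, v (algebraMap K L (x i))) ^ v.mult =
      (∏ v : InfinitePlace K, (⨆ i, v (x i)) ^ v.mult) ^ Module.finrank K L := by
  classical
  calc ∏ v : InfinitePlace L, (⨆ i, v (algebraMap K L (x i))) ^ v.mult
      = ∏ ψ : L →+* ℂ, ⨆ i, (InfinitePlace.mk ψ).val (algebraMap K L (x i)) :=
        prod_infinitePlace_pow_mult fun v ↦ ⨆ i, v (algebraMap K L (x i))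
    _ = ∏ φ : K →+* ℂ, ∏ ψ : L →+* ℂ with ψ.comp (algebraMap K L) = φ,
          ⨆ i, (InfinitePlace.mk ψ).val (algebraMap K L (x i)) :=
        (Finset.prod_fiberwise ..).symm
    _ = ∏ φ : K →+* ℂ, (⨆ i, (InfinitePlace.mk φ).val (x i)) ^ Module.finrank K L := by
        refine Finset.prod_congr rfl fun φ _ ↦ ?_
        rw [← card_embeddings_extending (L := L) φ, ← Finset.prod_const]
        refine Finset.prod_congr rfl fun ψ hψ ↦ ?_
        rw [← (Finset.mem_filter.mp hψ).2]
        rfl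
    _ = (∏ φ : K →+* ℂ, ⨆ i, (InfinitePlace.mk φ).val (x i)) ^ Module.finrank K L :=
        Finset.prod_pow ..
    _ = _ := congrArg (· ^ _) (prod_infinitePlace_pow_mult fun v ↦ ⨆ i, v (x i)).symm

lemma finprod_finitePlace_iSup_algebraMap {ι : Type*} [Finite ι] {x : ι → 𝓞 K} (hx : x ≠ 0) :
    ∏ᶠ v : FinitePlace L, ⨆ i, v (algebraMap K L (x i)) =
      (∏ᶠ v : FinitePlace K, ⨆ i, v (x i : K)) ^ Module.finrank K L := by
  let y : ι → 𝓞 L := fun i ↦ algebraMap (𝓞 K) (𝓞 L) (x i)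
  have hy : y ≠ 0 := by
    obtain ⟨i, hi⟩ := ne_iff.mp hx
    exact ne_iff.mpr ⟨i, (map_ne_zero_iff _ (FaithfulSMul.algebraMap_injective _ _)).mpr hi⟩
  have hspan : Ideal.span (Set.range y) =
      (Ideal.span (Set.range x)).map (algebraMap (𝓞 K) (𝓞 L)) := by
    rw [Ideal.map_span, ← Set.range_comp]; rfl
  have hdeg : Module.finrank (𝓞 K) (𝓞 L) = Module.finrank K L :=
    (IsFractionRing.finrank_eq (𝓞 K) K (𝓞 L) L).symm
  have hK := absNorm_mul_finprod_finitePlace_eq_one hx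
  have hL := absNorm_mul_finprod_finitePlace_eq_one hy
  rw [hspan, Ideal.absNorm_algebraMap, hdeg, Nat.cast_pow] at hL
  rw [eq_inv_of_mul_eq_one_right hK, inv_pow, ← eq_inv_of_mul_eq_one_right hL]
  rfl

lemma mulHeight_algebraMap_integers {ι : Type*} [Finite ι] {x : ι → 𝓞 K} (hx : x ≠ 0) :
    mulHeight (fun i ↦ algebraMap K L (x i)) =
      mulHeight (fun i ↦ (x i : K)) ^ Module.finrank K L := by
  obtain ⟨i, hi⟩ := ne_iff.mp hx
  rw [NumberField.mulHeight_eq (ne_iff.mpr ⟨i, by simpa using hi⟩),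
    NumberField.mulHeight_eq (ne_iff.mpr ⟨i, by simpa using hi⟩), mul_pow,
    prod_infinitePlace_iSup_algebraMap, finprod_finitePlace_iSup_algebraMap hx]

theorem mulHeight_algebraMap {ι : Type*} [Finite ι] (x : ι → K) :
    mulHeight (fun i ↦ algebraMap K L (x i)) = mulHeight x ^ Module.finrank K L := by
  rcases eq_or_ne x 0 with rfl | hx
  · simp
  obtain ⟨b, hb⟩ := IsLocalization.exist_integer_multiples_of_finite (nonZeroDivisors (𝓞 K)) x
  choose y hy using hb
  have hb0 : ((b : 𝓞 K) : K) ≠ 0 := by simp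
  have hyx : (fun i ↦ (y i : K)) = ((b : 𝓞 K) : K) • x :=
    funext fun i ↦ (hy i).trans (Algebra.smul_def ..)
  have hy0 : y ≠ 0 := by
    rintro rfl
    exact smul_ne_zero hb0 hx (hyx.symm.trans (funext fun _ ↦ map_zero _))
  have hyx' : (fun i ↦ algebraMap K L (y i)) =
      algebraMap K L ((b : 𝓞 K) : K) • fun i ↦ algebraMap K L (x i) :=
    funext fun i ↦ (congrArg _ (congrFun hyx i)).trans (map_mul ..)
  have key := mulHeight_algebraMap_integers (L := L) hy0
  rwa [hyx, hyx', mulHeight_smul_eq_mulHeight _ hb0,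
    mulHeight_smul_eq_mulHeight _ (by simp)] at key

theorem logHeight_algebraMap {ι : Type*} [Finite ι] (x : ι → K) :
    logHeight (fun i ↦ algebraMap K L (x i)) = Module.finrank K L * logHeight x := by
  rw [logHeight_eq_log_mulHeight, mulHeight_algebraMap, Real.log_pow,
    ← logHeight_eq_log_mulHeight]

end Extension

/-! ### Order of vanishing of a univariate polynomial -/

section SumBound

variable {K : Type*} [Field K] {v : AbsoluteValue K ℝ} {bd : ℕ → ℝ} {B : ℝ}

/-- The number `bd s` bounds `v x` whenever `x` is a sum of `s` elements of bounded absolute value.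
Archimedean and nonarchimedean absolute values differ only in the size of `bd s`, so that
estimates by induction on the number of summands can treat both at once. -/
structure IsSumBound (v : AbsoluteValue K ℝ) (bd : ℕ → ℝ) : Prop where
  nonneg (s : ℕ) : 0 ≤ bd s
  monotone : Monotone bd
  add_le {x y : K} {s t : ℕ} (hx : v x ≤ bd s) (hy : v y ≤ bd t) : v (x + y) ≤ bd (s + t)

lemma isSumBound_mul (v : AbsoluteValue K ℝ) (hB : 0 ≤ B) : IsSumBound v fun s ↦ s * B where
  nonneg s := by positivity
  monotone s t hst := mul_le_mul_of_nonneg_right (Nat.cast_le.mpr hst) hB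
  add_le hx hy := (v.add_le _ _).trans (by push_cast; linarith)

lemma isSumBound_ite (hv : IsNonarchimedean v) (hB : 0 ≤ B) :
    IsSumBound v fun s ↦ if s = 0 then 0 else B where
  nonneg s := by split_ifs <;> simp [hB]
  monotone s t hst := by
    dsimp only
    split_ifs with hs ht <;> first | omega | exact hB | exact le_rfl
  add_le hx hy := by
    refine (hv _ _).trans (max_le (hx.trans ?_) (hy.trans ?_)) <;> split_ifs <;>
      first | omega | exact hB | exact le_rfl

end SumBound

section Division

open Polynomial

variable {K : Type*} [Field K] {v : AbsoluteValue K ℝ} {bd : ℕ → ℝ} {β : K}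

lemma apply_coeff_le_of_apply_root_le_one (hbd : IsSumBound v bd) (hβ : v β ≤ 1) {k d : ℕ}
    {q : K[X]} (hd : ((X - C β) ^ k * q).natDegree ≤ d)
    (hcoeff : ∀ i, v (((X - C β) ^ k * q).coeff i) ≤ bd 1) (j : ℕ) :
    v (q.coeff j) ≤ bd ((d - j).choose k) := by
  induction k generalizing q j with
  | zero => simpa using hcoeff j
  | succ k ih =>
    have hfactor : (X - C β) ^ (k + 1) * q = (X - C β) ^ k * ((X - C β) * q) := by ring
    have hquot := ih (q := (X - C β) * q) (by rwa [← hfactor]) (by rwa [← hfactor])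
    have hrec (j : ℕ) : q.coeff j = ((X - C β) * q).coeff (j + 1) + β * q.coeff (j + 1) := by
      rw [sub_mul, coeff_sub, coeff_X_mul, coeff_C_mul, sub_add_cancel]
    induction h : d - j generalizing j with
    | zero =>
      have hq0 : q.coeff j = 0 := by
        rcases eq_or_ne q 0 with rfl | hq
        · simp
        · rw [natDegree_mul (pow_ne_zero _ (X_sub_C_ne_zero β)) hq, natDegree_pow,
            natDegree_X_sub_C] at hd
          exact coeff_eq_zero_of_natDegree_lt (by omega)
      rw [hq0, map_zero]
      exact hbd.nonneg _
    | succ e ihe =>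
      rw [hrec, Nat.choose_succ_succ']
      refine hbd.add_le ?_ ?_
      · simpa [show d - (j + 1) = e by omega] using hquot (j + 1)
      · rw [map_mul]
        exact (mul_le_of_le_one_left (v.nonneg _) hβ).trans (ihe (j + 1) (by omega))

lemma reverse_X_sub_C (hβ : β ≠ 0) : (X - C β).reverse = C (-β) * (X - C β⁻¹) := by
  have hX : (X : K[X]).reverse = 1 := by
    rw [← mul_one X, reverse_X_mul, ← C_1, reverse_C]
  rw [sub_eq_add_neg, ← C_neg, reverse_add_C, hX, natDegree_X, pow_one, mul_sub, ← C_mul,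
    neg_mul, mul_inv_cancel₀ hβ, C_neg, C_neg, C_1]
  ring

lemma reverse_X_sub_C_pow_mul (hβ : β ≠ 0) (k : ℕ) (q : K[X]) :
    ((X - C β) ^ k * q).reverse = (X - C β⁻¹) ^ k * (C ((-β) ^ k) * q.reverse) := by
  induction k with
  | zero => simp
  | succ k ih =>
    rw [pow_succ', mul_assoc, reverse_mul_of_domain, ih, reverse_X_sub_C hβ, pow_succ (-β), C_mul]
    ring

lemma max_apply_root_pow_mul_apply_coeff_le (hbd : IsSumBound v bd) {k : ℕ} {q : K[X]}
    (hcoeff : ∀ i, v (((X - C β) ^ k * q).coeff i) ≤ bd 1) (j : ℕ) :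
    max (v β ^ k) 1 * v (q.coeff j) ≤ bd (2 ^ ((X - C β) ^ k * q).natDegree) := by
  have hchoose (i d : ℕ) : bd ((d - i).choose k) ≤ bd (2 ^ d) :=
    hbd.monotone ((Nat.choose_le_two_pow _ _).trans
      (Nat.pow_le_pow_right two_pos (Nat.sub_le d i)))
  rcases le_or_gt (v β) 1 with hβ | hβ
  · rw [max_eq_right (pow_le_one₀ (v.nonneg _) hβ), one_mul]
    exact (apply_coeff_le_of_apply_root_le_one hbd hβ le_rfl hcoeff j).trans (hchoose _ _)
  · have hβ0 : β ≠ 0 := v.pos_iff.mp (one_pos.trans hβ)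
    rw [max_eq_left (one_le_pow₀ hβ.le)]
    rcases lt_or_ge q.natDegree j with hj | hj
    · rw [coeff_eq_zero_of_natDegree_lt hj, map_zero, mul_zero]
      exact hbd.nonneg _
    have hrev := reverse_X_sub_C_pow_mul hβ0 k q
    have hquot := apply_coeff_le_of_apply_root_le_one hbd
      (by rw [map_inv₀]; exact inv_le_one_of_one_le₀ hβ.le)
      (hrev ▸ reverse_natDegree_le _) (fun i ↦ by rw [← hrev, coeff_reverse]; exact hcoeff _)
      (q.natDegree - j)
    rw [coeff_C_mul, coeff_reverse, revAt_le (Nat.sub_le _ _), Nat.sub_sub_self hj, map_mul,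
      map_pow, v.map_neg] at hquot
    exact hquot.trans (hchoose _ _)

lemma apply_coeff_le_iSup (v : AbsoluteValue K ℝ) (p : K[X]) (i : ℕ) :
    v (p.coeff i) ≤ ⨆ s : p.support, v (p.coeff s) := by
  by_cases hi : i ∈ p.support
  · exact Finite.le_ciSup_of_le (f := fun s : p.support ↦ v (p.coeff s)) ⟨i, hi⟩ le_rfl
  · rw [notMem_support_iff.mp hi, map_zero]
    exact Real.iSup_nonneg fun _ ↦ v.nonneg _

lemma iSup_apply_root_pow_mul_coeff_le (hbd : IsSumBound v bd) {k : ℕ} {q : K[X]}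
    (hcoeff : ∀ i, v (((X - C β) ^ k * q).coeff i) ≤ bd 1) :
    (⨆ a : Fin 2 × q.support, v (![β ^ k, 1] a.1 * q.coeff a.2)) ≤
      bd (2 ^ ((X - C β) ^ k * q).natDegree) := by
  refine Real.iSup_le (fun ⟨i, j⟩ ↦ ?_) (hbd.nonneg _)
  rw [map_mul]
  refine le_trans (mul_le_mul_of_nonneg_right ?_ (v.nonneg _))
    (max_apply_root_pow_mul_apply_coeff_le hbd hcoeff j)
  fin_cases i <;> simp

end Division

section OrderOfVanishing

open AdmissibleAbsValues Polynomial

variable {K : Type*} [Field K] [AdmissibleAbsValues K]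

theorem mul_logHeight₁_le_of_pow_X_sub_C_dvd {p : K[X]} (hp : p ≠ 0) {β : K} {k : ℕ}
    (hdvd : (X - C β) ^ k ∣ p) :
    k * logHeight₁ β ≤
      logHeight (fun s : p.support ↦ p.coeff s) + totalWeight K * (p.natDegree * Real.log 2) := by
  obtain ⟨q, rfl⟩ := hdvd
  have hsupp {f : K[X]} (hf : f ≠ 0) : (fun s : f.support ↦ f.coeff s) ≠ 0 := by
    obtain ⟨s, hs⟩ := support_nonempty.mpr hf
    exact Function.ne_iff.mpr ⟨⟨s, hs⟩, mem_support_iff.mp hs⟩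
  have hq := hsupp (right_ne_zero_of_mul hp)
  have hprod := logHeight_fun_mul_eq (x := ![β ^ k, 1]) (Function.ne_iff.mpr ⟨1, by simp⟩) hq
  rw [← logHeight₁_eq_logHeight, logHeight₁_pow] at hprod
  have hprod0 : (fun a : Fin 2 × q.support ↦ ![β ^ k, 1] a.1 * q.coeff a.2) ≠ 0 := by
    obtain ⟨s, hs⟩ := Function.ne_iff.mp hq
    exact Function.ne_iff.mpr ⟨(1, s), by simpa using hs⟩
  have hnonneg (v : AbsoluteValue K ℝ) := Real.iSup_nonneg fun s :
    ((X - C β) ^ k * q).support ↦ v.nonneg (((X - C β) ^ k * q).coeff s)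
  have hle := logHeight_le_of_local (hsupp hp) hprod0
    (C := 2 ^ ((X - C β) ^ k * q).natDegree) (by positivity) 1 (fun v _ ↦ ?_) fun v hv ↦ ?_
  · rw [hprod, Real.log_pow, Nat.cast_one, one_mul] at hle
    linarith [logHeight_nonneg fun s : q.support ↦ q.coeff s]
  · simpa using iSup_apply_root_pow_mul_coeff_le (isSumBound_mul v (hnonneg v))
      (fun i ↦ by simpa using apply_coeff_le_iSup v ((X - C β) ^ k * q) i)
  · simpa using iSup_apply_root_pow_mul_coeff_le
      (isSumBound_ite (AdmissibleAbsValues.isNonarchimedean v hv) (hnonneg v))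
      (fun i ↦ by simpa using apply_coeff_le_iSup v ((X - C β) ^ k * q) i)

end OrderOfVanishing

open MvPolynomial

/-! ### Translation and Hasse derivatives -/

section Translate

variable {σ τ R : Type*} [CommSemiring R]

/-- Translation `f(x) ↦ f(x + β)`, so that the coefficients of `translate β f` are the Taylor
coefficients of `f` at `β`. -/
noncomputable def translate (β : σ → R) : MvPolynomial σ R →ₐ[R] MvPolynomial σ R :=
  aeval fun h ↦ X h + C (β h)

@[simp]
lemma translate_C (β : σ → R) (a : R) : translate β (C a) = C a := by
  simp [translate, algebraMap_eq]

@[simp]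
lemma translate_X (β : σ → R) (h : σ) : translate β (X h) = X h + C (β h) := by
  simp [translate]

lemma pderiv_translate (β : σ → R) (h : σ) (f : MvPolynomial σ R) :
    pderiv h (translate β f) = translate β (pderiv h f) := by
  classical
  induction f using MvPolynomial.induction_on with
  | C a => simp
  | add p q hp hq => simp [hp, hq]
  | mul_X p g hp =>
    have hX : pderiv h (X g + C (β g)) = translate β (pderiv h (X g)) := by
      rcases eq_or_ne g h with rfl | hg
      · simp
      · simp [pderiv_X_of_ne hg]
    rw [map_mul, pderiv_mul, pderiv_mul, map_add, map_mul, map_mul, hp, translate_X, hX]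

lemma coeff_zero_translate (β : σ → R) (f : MvPolynomial σ R) :
    coeff 0 (translate β f) = eval β f := by
  rw [← constantCoeff_eq]
  induction f using MvPolynomial.induction_on with
  | C a => simp
  | add p q hp hq => simp [hp, hq]
  | mul_X p g hp => simp [hp]

lemma translate_injective {R : Type*} [CommRing R] (β : σ → R) :
    Function.Injective (translate β) := by
  have hinv : (translate (-β)).comp (translate β) = AlgHom.id R _ := by
    ext g; simp
  exact Function.LeftInverse.injective (g := translate (-β)) (DFunLike.congr_fun hinv)

lemma translate_rename (e : σ → τ) (β : τ → R) (f : MvPolynomial σ R) :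
    translate β (rename e f) = rename e (translate (β ∘ e) f) := by
  have hcomp : (translate β).comp (rename e) = (rename e).comp (translate (β ∘ e)) := by
    ext x; simp
  exact DFunLike.congr_fun hcomp f

lemma map_translate {S : Type*} [CommSemiring S] (g : R →+* S) (β : σ → R)
    (f : MvPolynomial σ R) : map g (translate β f) = translate (g ∘ β) (map g f) := by
  induction f using MvPolynomial.induction_on with
  | C a => simp
  | add p q hp hq => simp [hp, hq]
  | mul_X p h hp => simp [hp]

end Translate

lemma multiIndex_induction {σ : Type*} {p : (σ →₀ ℕ) → Prop} (zero : p 0)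
    (step : ∀ I h, p I → p (I + Finsupp.single h 1)) (I : σ →₀ ℕ) : p I := by
  suffices hadd : ∀ J, p J → p (J + I) by simpa using hadd 0 zero
  induction I using Finsupp.induction_linear with
  | zero => simp
  | add f g hf hg => intro J hJ; rw [← add_assoc]; exact hg _ (hf _ hJ)
  | single h n =>
    intro J hJ
    induction n with
    | zero => simpa using hJ
    | succ n ih => rw [Finsupp.single_add, ← add_assoc]; exact step _ _ ih

section Hasse

variable {σ R : Type*} [Fintype σ] [CommSemiring R]

/-- The Hasse derivative of multi-index `I`, i.e. the operator `∂_I` with its division by `I!`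
carried out on monomials, so that it makes sense over any semiring. -/
noncomputable def hasse (I : σ →₀ ℕ) : MvPolynomial σ R →ₗ[R] MvPolynomial σ R :=
  (basisMonomials σ R).constr R fun J ↦ monomial (J - I) (∏ h, ((J h).choose (I h) : R))

lemma hasse_monomial (I J : σ →₀ ℕ) (c : R) :
    hasse I (monomial J c) = monomial (J - I) (c * ∏ h, ((J h).choose (I h) : R)) := by
  have hbasis : monomial J c = c • basisMonomials σ R J := by simp [smul_monomial]
  rw [hbasis, map_smul, hasse, Module.Basis.constr_basis, smul_monomial, smul_eq_mul]

lemma coeff_hasse (I J : σ →₀ ℕ) (f : MvPolynomial σ R) :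
    coeff J (hasse I f) = (∏ h, ((J h + I h).choose (I h) : R)) * coeff (J + I) f := by
  classical
  induction f using MvPolynomial.induction_on' with
  | add p q hp hq => rw [map_add, coeff_add, hp, hq, coeff_add, mul_add]
  | monomial S c =>
    rw [hasse_monomial, coeff_monomial, coeff_monomial]
    rcases eq_or_ne S (J + I) with rfl | hS
    · simp [mul_comm]
    rw [if_neg hS, mul_zero]
    split_ifs with hJ
    · have hlt : ∃ g, S g < I g := by
        by_contra! hle
        exact hS (by rw [← hJ, tsub_add_cancel_of_le hle])
      obtain ⟨g, hg⟩ := hlt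
      rw [Finset.prod_eq_zero (mem_univ g) (by rw [Nat.choose_eq_zero_of_lt hg, Nat.cast_zero]),
        mul_zero]
    · rfl

@[simp]
lemma hasse_zero (f : MvPolynomial σ R) : hasse 0 f = f := by
  ext J
  simp [coeff_hasse]

lemma degreeOf_hasse_le (I : σ →₀ ℕ) (h : σ) (f : MvPolynomial σ R) :
    degreeOf h (hasse I f) ≤ degreeOf h f := by
  refine degreeOf_le_iff.mpr fun J hJ ↦ ?_
  rw [mem_support_iff, coeff_hasse] at hJ
  calc J h ≤ (J + I) h := Nat.le_add_right _ _
    _ ≤ degreeOf h f :=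
      degreeOf_le_iff.mp le_rfl _ (mem_support_iff.mpr (right_ne_zero_of_mul hJ))

lemma pderiv_hasse (I : σ →₀ ℕ) (h : σ) (f : MvPolynomial σ R) :
    pderiv h (hasse I f) = ((I h : R) + 1) • hasse (I + Finsupp.single h 1) f := by
  classical
  ext J
  have hchoose : ((J h + 1 + I h).choose (I h) : R) * (J h + 1) =
      (I h + 1) * ((J h + (I h + 1)).choose (I h + 1) : R) := by
    have hsucc := Nat.choose_succ_right_eq (J h + (I h + 1)) (I h)
    rw [show J h + (I h + 1) - I h = J h + 1 by omega] at hsucc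
    rw [show J h + 1 + I h = J h + (I h + 1) by omega, mul_comm ((I h : R) + 1)]
    exact_mod_cast congrArg (Nat.cast (R := R)) hsucc.symm
  have hrest : ∏ g ∈ univ.erase h, (((J + Finsupp.single h 1 : σ →₀ ℕ) g + I g).choose (I g) : R) =
      ∏ g ∈ univ.erase h, ((J g + (I + Finsupp.single h 1 : σ →₀ ℕ) g).choose
        ((I + Finsupp.single h 1 : σ →₀ ℕ) g) : R) := by
    refine Finset.prod_congr rfl fun g hg ↦ ?_
    simp [(Finset.ne_of_mem_erase hg).symm]
  rw [coeff_pderiv, coeff_smul, coeff_hasse, coeff_hasse, smul_eq_mul,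
    ← Finset.mul_prod_erase univ _ (mem_univ h), ← Finset.mul_prod_erase univ _ (mem_univ h),
    hrest, add_right_comm J, add_assoc J]
  simp only [Finsupp.add_apply, Finsupp.single_eq_same]
  rw [mul_right_comm, mul_right_comm _ _ ((J h : R) + 1), hchoose]
  ring

lemma pderiv_pow_hasse {I : σ →₀ ℕ} {h : σ} (hI : I h = 0) (n : ℕ) (f : MvPolynomial σ R) :
    ((pderiv h).toLinearMap ^ n : Module.End R (MvPolynomial σ R)) (hasse I f) =
      (n.factorial : R) • hasse (I + Finsupp.single h n) f := by
  induction n with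
  | zero => simp
  | succ n ih =>
    rw [pow_succ', Module.End.mul_apply, ih, map_smul]
    change _ • pderiv h _ = _
    rw [pderiv_hasse, smul_smul, add_assoc, ← Finsupp.single_add]
    simp [hI, Nat.factorial_succ, mul_comm]

lemma prod_map_pderiv_pow (I : σ → ℕ) {l : List σ} (hl : l.Nodup) (f : MvPolynomial σ R) :
    (l.map fun h ↦ ((pderiv h).toLinearMap ^ I h : Module.End R (MvPolynomial σ R))).prod f =
      (l.map fun h ↦ ((I h).factorial : R)).prod •
        hasse (l.map fun h ↦ Finsupp.single h (I h)).sum f := by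
  induction l with
  | nil => simp
  | cons a l ih =>
    rw [List.nodup_cons] at hl
    have ha : (l.map fun h ↦ Finsupp.single h (I h)).sum a = 0 := by
      rw [← Finsupp.applyAddHom_apply a, map_list_sum, List.map_map]
      refine List.sum_eq_zero fun x hx ↦ ?_
      obtain ⟨b, hb, rfl⟩ := List.mem_map.mp hx
      exact Finsupp.single_eq_of_ne fun hab ↦ hl.1 (hab ▸ hb)
    simp only [List.map_cons, List.prod_cons, List.sum_cons, Module.End.mul_apply]
    rw [ih hl.2, map_smul, pderiv_pow_hasse ha, smul_smul, mul_comm, add_comm]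

lemma dividedDeriv_eq_hasse {m : ℕ} (I : Fin m → ℕ) (P : MvPolynomial (Fin m) QBar) :
    dividedDeriv I P = hasse (Finsupp.equivFunOnFinite.symm I) P := by
  have hfactorial : ∏ h, ((I h).factorial : QBar) ≠ 0 :=
    Finset.prod_ne_zero_iff.mpr fun h _ ↦ Nat.cast_ne_zero.mpr (I h).factorial_ne_zero
  rw [dividedDeriv, List.ofFn_eq_map, prod_map_pderiv_pow I (List.nodup_finRange m),
    ← List.ofFn_eq_map, ← List.ofFn_eq_map, List.prod_ofFn, List.sum_ofFn,
    ← Finsupp.equivFunOnFinite_symm_eq_sum, inv_smul_smul₀ hfactorial]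

end Hasse

section Taylor

variable {σ R : Type*} [Fintype σ] [CommRing R] [IsDomain R] [CharZero R]

lemma hasse_translate (β : σ → R) (I : σ →₀ ℕ) (f : MvPolynomial σ R) :
    hasse I (translate β f) = translate β (hasse I f) := by
  induction I using multiIndex_induction with
  | zero => simp
  | step I h ih =>
    refine smul_right_injective _ (Nat.cast_add_one_ne_zero (R := R) (I h)) ?_
    change _ • _ = _ • translate β _
    rw [← pderiv_hasse, ih, pderiv_translate, pderiv_hasse, map_smul]

theorem coeff_translate (β : σ → R) (I : σ →₀ ℕ) (f : MvPolynomial σ R) :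
    coeff I (translate β f) = eval β (hasse I f) := by
  rw [← coeff_zero_translate, ← hasse_translate, coeff_hasse]
  simp

end Taylor

/-! ### Weighted orders -/

section WeightedOrder

variable {σ R : Type*} {w : σ → ℝ}

lemma weight_nonneg (hw : ∀ h, 0 ≤ w h) (I : σ →₀ ℕ) : 0 ≤ Finsupp.weight w I := by
  rw [Finsupp.weight_apply]
  exact Finset.sum_nonneg fun h _ ↦ nsmul_nonneg (hw h) _

section CommSemiring

variable [CommSemiring R] {t u : ℝ} {f g : MvPolynomial σ R}

/-- All monomials of `f` have weight at least `t`. Applied to `translate β P` with the weights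
`1 / r h`, it says that the index of `P` at `β` is at least `t`. A lower bound is used rather than
the minimum itself, which does not exist for the zero polynomial. -/
def WeightedOrderGE (w : σ → ℝ) (t : ℝ) (f : MvPolynomial σ R) : Prop :=
  ∀ I, coeff I f ≠ 0 → t ≤ Finsupp.weight w I

lemma exists_coeff_ne_zero_weightedOrderGE (w : σ → ℝ) (hf : f ≠ 0) :
    ∃ I, coeff I f ≠ 0 ∧ WeightedOrderGE w (Finsupp.weight w I) f := by
  obtain ⟨I, hI, hmin⟩ :=
    Finset.exists_min_image f.support (Finsupp.weight w) (support_nonempty.mpr hf)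
  exact ⟨I, mem_support_iff.mp hI, fun J hJ ↦ hmin J (mem_support_iff.mpr hJ)⟩

namespace WeightedOrderGE

lemma mono (hf : WeightedOrderGE w t f) (hut : u ≤ t) : WeightedOrderGE w u f :=
  fun I hI ↦ hut.trans (hf I hI)

lemma sum {ι : Type*} {s : Finset ι} {f : ι → MvPolynomial σ R}
    (hf : ∀ i ∈ s, WeightedOrderGE w t (f i)) : WeightedOrderGE w t (∑ i ∈ s, f i) := by
  intro I hI
  rw [coeff_sum] at hI
  obtain ⟨i, hi, hIi⟩ := Finset.exists_ne_zero_of_sum_ne_zero hI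
  exact hf i hi I hIi

lemma mul (hf : WeightedOrderGE w t f) (hg : WeightedOrderGE w u g) :
    WeightedOrderGE w (t + u) (f * g) := by
  classical
  intro I hI
  rw [coeff_mul] at hI
  obtain ⟨J, hJ, hne⟩ := Finset.exists_ne_zero_of_sum_ne_zero hI
  rw [← mem_antidiagonal.mp hJ, map_add]
  exact add_le_add (hf _ (left_ne_zero_of_mul hne)) (hg _ (right_ne_zero_of_mul hne))

lemma prod {ι : Type*} {s : Finset ι} {t : ι → ℝ} {f : ι → MvPolynomial σ R}
    (hf : ∀ i ∈ s, WeightedOrderGE w (t i) (f i)) :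
    WeightedOrderGE w (∑ i ∈ s, t i) (∏ i ∈ s, f i) := by
  classical
  induction s using Finset.induction_on with
  | empty =>
    intro I hI
    have hI0 : 0 = I := by
      by_contra hne
      exact hI (by rw [Finset.prod_empty, coeff_one, if_neg hne])
    simp [← hI0]
  | insert i s hi ih =>
    rw [Finset.sum_insert hi, Finset.prod_insert hi]
    exact (hf i (mem_insert_self i s)).mul (ih fun j hj ↦ hf j (mem_insert_of_mem hj))

lemma hasse [Fintype σ] (hw : ∀ h, 0 ≤ w h) (hf : WeightedOrderGE w t f) (J : σ →₀ ℕ) :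
    WeightedOrderGE w (max (t - Finsupp.weight w J) 0) (hasse J f) := by
  intro I hI
  rw [coeff_hasse] at hI
  have hIJ := hf _ (right_ne_zero_of_mul hI)
  rw [map_add] at hIJ
  exact max_le (by linarith) (weight_nonneg hw I)

end WeightedOrderGE

end CommSemiring

lemma WeightedOrderGE.det [CommRing R] {ι : Type*} [Fintype ι] [DecidableEq ι] {t : ι → ℝ}
    {M : Matrix ι ι (MvPolynomial σ R)} (hM : ∀ a b, WeightedOrderGE w (t b) (M a b)) :
    WeightedOrderGE w (∑ b, t b) M.det := by
  rw [Matrix.det_apply]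
  refine WeightedOrderGE.sum fun τ _ I hI ↦ ?_
  refine WeightedOrderGE.prod (fun i _ ↦ hM (τ i) i) I fun h0 ↦ hI ?_
  rw [coeff_smul, h0, smul_zero]

end WeightedOrder

/-! ### Generalized Wronskians -/

section Annihilators

lemma exists_linearIndependent_comp {F V ι : Type*} [DivisionRing F] [AddCommGroup V] [Module F V]
    (v : ι → V) (d : ι → ℕ) (n : ℕ)
    (h : ∀ a < n, ∀ I : Fin a → ι, (∀ i, d (I i) ≤ i) →
      ∃ J, d J ≤ a ∧ v J ∉ Submodule.span F (Set.range (v ∘ I))) :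
    ∃ I : Fin n → ι, (∀ i, d (I i) ≤ i) ∧ LinearIndependent F (v ∘ I) := by
  induction n with
  | zero => exact ⟨Fin.elim0, fun i ↦ i.elim0, linearIndependent_empty_type⟩
  | succ a ih =>
    obtain ⟨I, hI, hlin⟩ := ih fun b hb ↦ h b (hb.trans a.lt_succ_self)
    obtain ⟨J, hJ, hJI⟩ := h a a.lt_succ_self I hI
    refine ⟨Fin.snoc I J, Fin.lastCases (by simpa using hJ) fun i ↦ by simpa using hI i, ?_⟩
    rw [Fin.comp_snoc]
    exact linearIndependent_finSnoc.mpr ⟨hlin, hJI⟩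

lemma exists_ne_zero_forall_mem_dotProduct_eq_zero {A F ι : Type*} [CommRing A] [IsDomain A]
    [Field F] [Algebra A F] [IsFractionRing A F] [Fintype ι] {p : Submodule F (ι → F)}
    (hp : p < ⊤) : ∃ μ : ι → A, μ ≠ 0 ∧ ∀ v ∈ p, (algebraMap A F ∘ μ) ⬝ᵥ v = 0 := by
  classical
  obtain ⟨l, hl, hpl⟩ := Submodule.exists_le_ker_of_lt_top _ hp
  obtain ⟨y, rfl⟩ := (dotProductEquiv F ι).surjective l
  obtain ⟨b, hb⟩ := IsLocalization.exist_integer_multiples_of_finite (nonZeroDivisors A) y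
  choose μ hμ using hb
  have hμy : algebraMap A F ∘ μ = (b : A) • y := funext hμ
  refine ⟨μ, ?_, fun v hv ↦ ?_⟩
  · rintro rfl
    have hy : (b : A) • y = 0 := by rw [← hμy]; ext; simp
    rw [smul_eq_zero_iff_right (nonZeroDivisors.coe_ne_zero b)] at hy
    exact hl (by rw [hy, map_zero])
  · have hyv : y ⬝ᵥ v = 0 := hpl hv
    rw [hμy, smul_dotProduct, hyv, smul_zero]

variable {σ R ι : Type*} [Fintype σ] [Fintype ι]

lemma pderiv_sum_mul_hasse [CommSemiring R] (φ μ : ι → MvPolynomial σ R) (h : σ) (J : σ →₀ ℕ) :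
    pderiv h (∑ j, μ j * hasse J (φ j)) = ∑ j, pderiv h (μ j) * hasse J (φ j) +
      ((J h : R) + 1) • ∑ j, μ j * hasse (J + Finsupp.single h 1) (φ j) := by
  simp only [map_sum, pderiv_mul, Finset.sum_add_distrib, pderiv_hasse, mul_smul_comm,
    Finset.smul_sum]

/-- The vector `μ` is a linear relation between the columns of the matrix formed by the Hasse
derivatives of order less than `a` of the polynomials `φ j`. -/
def AnnihilatesHasse [CommSemiring R] (φ : ι → MvPolynomial σ R) (a : ℕ)
    (μ : ι → MvPolynomial σ R) : Prop :=
  ∀ J : σ →₀ ℕ, J.degree < a → ∑ j, μ j * hasse J (φ j) = 0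

variable [CommRing R] [IsDomain R] [CharZero R] {φ : ι → MvPolynomial σ R} {a : ℕ}

lemma AnnihilatesHasse.succ_stable
    (hstable : ∀ μ, AnnihilatesHasse φ a μ → AnnihilatesHasse φ (a + 1) μ)
    {μ : ι → MvPolynomial σ R} (hμ : AnnihilatesHasse φ (a + 1) μ) :
    AnnihilatesHasse φ (a + 2) μ := by
  have hpderiv (h : σ) : AnnihilatesHasse φ (a + 1) fun j ↦ pderiv h (μ j) := by
    refine hstable _ fun J hJ ↦ ?_
    have hsum := pderiv_sum_mul_hasse φ μ h J
    rwa [hμ J (by omega), hμ (J + Finsupp.single h 1) (by simpa using hJ), smul_zero, map_zero,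
      add_zero, eq_comm] at hsum
  intro J hJ
  induction J using multiIndex_induction with
  | zero => exact hμ 0 (by simp)
  | step J h _ =>
    have hJ' : J.degree < a + 1 := by
      rw [map_add, Finsupp.degree_single] at hJ
      omega
    have hsum := pderiv_sum_mul_hasse φ μ h J
    rw [hμ J hJ', hpderiv h J hJ', map_zero, zero_add, eq_comm] at hsum
    exact (smul_eq_zero_iff_right (Nat.cast_add_one_ne_zero _)).mp hsum

lemma AnnihilatesHasse.of_stable
    (hstable : ∀ μ, AnnihilatesHasse φ a μ → AnnihilatesHasse φ (a + 1) μ)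
    {μ : ι → MvPolynomial σ R} (hμ : AnnihilatesHasse φ a μ) (d : ℕ) :
    AnnihilatesHasse φ (a + d) μ := by
  induction d generalizing a with
  | zero => exact hμ
  | succ d ih =>
    rw [← Nat.succ_add_eq_add_succ]
    exact ih (fun _ ↦ AnnihilatesHasse.succ_stable hstable) (hstable μ hμ)

/-- Evaluating the relations at a point `x` shows that `∑ j, μ j (x) • φ j` has vanishing Taylor
expansion at `x`. -/
lemma eq_zero_of_forall_annihilatesHasse (hφ : LinearIndependent R φ)
    {μ : ι → MvPolynomial σ R} (hμ : ∀ a, AnnihilatesHasse φ a μ) : μ = 0 := by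
  refine funext fun j ↦ MvPolynomial.funext fun x ↦ ?_
  have hrel : ∑ j, eval x (μ j) • φ j = 0 := by
    refine translate_injective x (MvPolynomial.ext _ _ fun J ↦ ?_)
    rw [coeff_translate, map_zero, coeff_zero]
    simpa [smul_eval] using congrArg (eval x) (hμ _ J J.degree.lt_succ_self)
  simpa using Fintype.linearIndependent_iff.mp hφ _ hrel j

end Annihilators

section Wronskian

variable {σ ι R : Type*} [Fintype σ] [Fintype ι] [DecidableEq ι] [CommRing R]

/-- The generalized Wronskian of the polynomials `φ j` whose rows are their Hasse derivatives of
multi-indices `I i`. -/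
noncomputable def wronskian (I : ι → σ →₀ ℕ) (φ : ι → MvPolynomial σ R) : MvPolynomial σ R :=
  (Matrix.of fun i j ↦ hasse (I i) (φ j)).det

variable [IsDomain R] [CharZero R] {n : ℕ} {φ : Fin n → MvPolynomial σ R}

lemma exists_hasse_notMem_span {F : Type*} [Field F] [Algebra (MvPolynomial σ R) F]
    [IsFractionRing (MvPolynomial σ R) F] (hφ : LinearIndependent R φ) {a : ℕ} (ha : a < n)
    {I : Fin a → σ →₀ ℕ} (hI : ∀ i, (I i).degree ≤ i) :
    ∃ J : σ →₀ ℕ, J.degree ≤ a ∧ algebraMap _ F ∘ (fun j ↦ hasse J (φ j)) ∉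
      Submodule.span F (Set.range fun i ↦ algebraMap _ F ∘ fun j ↦ hasse (I i) (φ j)) := by
  set row : (σ →₀ ℕ) → Fin n → F := fun J ↦ algebraMap _ F ∘ fun j ↦ hasse J (φ j)
  by_contra! hall
  have hspan : Submodule.span F (Set.range (row ∘ I)) < ⊤ := by
    refine lt_top_iff_ne_top.mpr fun htop ↦ ?_
    have hrank := finrank_range_le_card (R := F) (row ∘ I)
    rw [Set.finrank, htop, finrank_top, Module.finrank_fin_fun, Fintype.card_fin] at hrank
    omega
  have hdot (μ : Fin n → MvPolynomial σ R) (J : σ →₀ ℕ) :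
      (algebraMap _ F ∘ μ) ⬝ᵥ row J = 0 ↔ ∑ j, μ j * hasse J (φ j) = 0 := by
    rw [← map_eq_zero_iff (algebraMap _ F) (IsFractionRing.injective (MvPolynomial σ R) F)]
    simp [row, dotProduct]
  have hstable (μ) (hμ : AnnihilatesHasse φ a μ) : AnnihilatesHasse φ (a + 1) μ := by
    intro J hJ
    rw [← hdot]
    refine Submodule.span_induction (p := fun v _ ↦ (algebraMap _ F ∘ μ) ⬝ᵥ v = 0) ?_
      (dotProduct_zero _) (fun u v _ _ hu hv ↦ by rw [dotProduct_add, hu, hv, add_zero])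
      (fun c v _ hv ↦ by rw [dotProduct_smul, hv, smul_zero]) (hall J (Nat.lt_succ_iff.mp hJ))
    rintro _ ⟨i, rfl⟩
    exact (hdot μ (I i)).mpr (hμ _ ((hI i).trans_lt i.2))
  obtain ⟨μ, hμ0, hμ⟩ :=
    exists_ne_zero_forall_mem_dotProduct_eq_zero (A := MvPolynomial σ R) hspan
  have hann : AnnihilatesHasse φ a μ := fun J hJ ↦ (hdot μ J).mp (hμ _ (hall J hJ.le))
  exact hμ0 (eq_zero_of_forall_annihilatesHasse hφ fun b J hJ ↦
    AnnihilatesHasse.of_stable hstable hann b J (by omega))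

theorem exists_wronskian_ne_zero (hφ : LinearIndependent R φ) :
    ∃ I : Fin n → σ →₀ ℕ, (∀ i, (I i).degree ≤ i) ∧ wronskian I φ ≠ 0 := by
  let F := FractionRing (MvPolynomial σ R)
  obtain ⟨I, hI, hlin⟩ := exists_linearIndependent_comp
    (fun J ↦ algebraMap (MvPolynomial σ R) F ∘ fun j ↦ hasse J (φ j)) Finsupp.degree n
    fun a ha I hI ↦ exists_hasse_notMem_span hφ ha hI
  refine ⟨I, hI, fun hW ↦ ?_⟩
  have hrows : LinearIndependent F
      (Matrix.of fun i j ↦ algebraMap _ F (hasse (I i) (φ j))).row := hlin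
  rw [Matrix.linearIndependent_rows_iff_isUnit, Matrix.isUnit_iff_isUnit_det] at hrows
  refine hrows.ne_zero ?_
  rw [← map_zero (algebraMap (MvPolynomial σ R) F), ← hW, wronskian, RingHom.map_det]
  rfl

end Wronskian

/-! ### Polynomials in disjoint sets of variables -/

section DisjointVariables

variable {σ τ R : Type*} [CommSemiring R]

/-- The product of two polynomials in disjoint sets of variables, as a bilinear map. -/
noncomputable def tmul : MvPolynomial σ R →ₗ[R] MvPolynomial τ R →ₗ[R] MvPolynomial (σ ⊕ τ) R :=
  (LinearMap.mul R (MvPolynomial (σ ⊕ τ) R)).compl₁₂ (rename Sum.inl).toLinearMap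
    (rename Sum.inr).toLinearMap

lemma tmul_apply (f : MvPolynomial σ R) (g : MvPolynomial τ R) :
    tmul f g = rename Sum.inl f * rename Sum.inr g := rfl

lemma tmul_monomial (I : σ →₀ ℕ) (J : τ →₀ ℕ) (a b : R) :
    tmul (monomial I a) (monomial J b) = monomial (I.sumElim J) (a * b) := by
  rw [tmul_apply, rename_monomial, rename_monomial, monomial_mul, Finsupp.sumElim_eq_add]

lemma exists_eq_sumElim (S : σ ⊕ τ →₀ ℕ) : ∃ I J, S = Finsupp.sumElim I J :=
  ⟨_, _, (Finsupp.comapDomain_sumElim_comapDomain S).symm⟩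

lemma sumElim_inj {I I' : σ →₀ ℕ} {J J' : τ →₀ ℕ} :
    I.sumElim J = I'.sumElim J' ↔ I = I' ∧ J = J' := by
  simp only [DFunLike.ext_iff, Sum.forall, Finsupp.sumElim_inl, Finsupp.sumElim_inr]

lemma weight_sumElim (w : σ ⊕ τ → ℝ) (I : σ →₀ ℕ) (J : τ →₀ ℕ) :
    Finsupp.weight w (I.sumElim J) =
      Finsupp.weight (w ∘ Sum.inl) I + Finsupp.weight (w ∘ Sum.inr) J := by
  rw [Finsupp.sumElim_eq_add, map_add]
  simp only [Finsupp.weight_apply]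
  rw [Finsupp.sum_mapDomain_index_inj Sum.inl_injective,
    Finsupp.sum_mapDomain_index_inj Sum.inr_injective]
  rfl

lemma coeff_tmul (f : MvPolynomial σ R) (g : MvPolynomial τ R) (I : σ →₀ ℕ) (J : τ →₀ ℕ) :
    coeff (I.sumElim J) (tmul f g) = coeff I f * coeff J g := by
  classical
  induction f using MvPolynomial.induction_on' with
  | add p q hp hq => rw [map_add, LinearMap.add_apply, coeff_add, hp, hq, coeff_add, add_mul]
  | monomial S c =>
    induction g using MvPolynomial.induction_on' with
    | add p q hp hq => rw [map_add, coeff_add, hp, hq, coeff_add, mul_add]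
    | monomial T d =>
      simp only [tmul_monomial, coeff_monomial, sumElim_inj, ite_and]
      split_ifs <;> simp

lemma translate_tmul (β : σ ⊕ τ → R) (f : MvPolynomial σ R) (g : MvPolynomial τ R) :
    translate β (tmul f g) = tmul (translate (β ∘ Sum.inl) f) (translate (β ∘ Sum.inr) g) := by
  rw [tmul_apply, map_mul, translate_rename, translate_rename, tmul_apply]

lemma hasse_tmul [Fintype σ] [Fintype τ] (I : σ →₀ ℕ) (J : τ →₀ ℕ) (f : MvPolynomial σ R)
    (g : MvPolynomial τ R) :
    hasse (I.sumElim J) (tmul f g) = tmul (hasse I f) (hasse J g) := by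
  ext S
  obtain ⟨A, B, rfl⟩ := exists_eq_sumElim S
  rw [coeff_tmul, coeff_hasse, coeff_hasse, coeff_hasse, ← Finsupp.sumElim_add, coeff_tmul,
    Fintype.prod_sum_type]
  simp only [Finsupp.sumElim_inl, Finsupp.sumElim_inr]
  exact mul_mul_mul_comm _ _ _ _

lemma tmul_ne_zero [NoZeroDivisors R] {f : MvPolynomial σ R} {g : MvPolynomial τ R} (hf : f ≠ 0)
    (hg : g ≠ 0) : tmul f g ≠ 0 :=
  mul_ne_zero (by simpa using (rename_injective _ Sum.inl_injective).ne hf)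
    (by simpa using (rename_injective _ Sum.inr_injective).ne hg)

lemma degreeOf_le_degreeOf_tmul_inl [NoZeroDivisors R] {f : MvPolynomial σ R}
    {g : MvPolynomial τ R} (hf : f ≠ 0) (hg : g ≠ 0) (h : σ) :
    degreeOf h f ≤ degreeOf (Sum.inl h) (tmul f g) := by
  have hne := tmul_ne_zero hf hg
  rw [tmul_apply] at hne ⊢
  rw [degreeOf_mul_eq (left_ne_zero_of_mul hne) (right_ne_zero_of_mul hne),
    degreeOf_rename_of_injective Sum.inl_injective]
  exact Nat.le_add_right _ _

lemma degreeOf_le_degreeOf_tmul_inr [NoZeroDivisors R] {f : MvPolynomial σ R}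
    {g : MvPolynomial τ R} (hf : f ≠ 0) (hg : g ≠ 0) (h : τ) :
    degreeOf h g ≤ degreeOf (Sum.inr h) (tmul f g) := by
  have hne := tmul_ne_zero hf hg
  rw [tmul_apply] at hne ⊢
  rw [degreeOf_mul_eq (left_ne_zero_of_mul hne) (right_ne_zero_of_mul hne),
    degreeOf_rename_of_injective Sum.inr_injective]
  exact Nat.le_add_left _ _

lemma exists_sum_tmul_eq [Unique τ] (P : MvPolynomial (σ ⊕ τ) R) {d : ℕ}
    (hd : P.degreeOf (Sum.inr default) ≤ d) :
    ∃ (φ : Fin (d + 1) → MvPolynomial σ R) (ψ : Fin (d + 1) → MvPolynomial τ R),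
      ∑ j, tmul (φ j) (ψ j) = P := by
  classical
  let g (S : σ ⊕ τ →₀ ℕ) : Fin (d + 1) := Fin.ofNat (d + 1) (S (Sum.inr default))
  refine ⟨fun b ↦ ∑ S ∈ P.support with g S = b,
      monomial (S.comapDomain Sum.inl Sum.inl_injective.injOn) (coeff S P),
    fun b ↦ monomial (Finsupp.single default (b : ℕ)) 1, ?_⟩
  have hsplit {S : σ ⊕ τ →₀ ℕ} (hS : S ∈ P.support) :
      (S.comapDomain Sum.inl Sum.inl_injective.injOn).sumElim
        (Finsupp.single default (g S : ℕ)) = S := by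
    ext (x | x)
    · simp
    · simp [Unique.eq_default x, g, Nat.mod_eq_of_lt (Nat.lt_succ_of_le
        (degreeOf_le_iff.mp hd S hS))]
  calc _ = ∑ b, ∑ S ∈ P.support with g S = b, monomial S (coeff S P) := by
        simp only [map_sum, LinearMap.sum_apply, tmul_monomial, mul_one]
        refine Finset.sum_congr rfl fun b _ ↦ Finset.sum_congr rfl fun S hS ↦ ?_
        obtain ⟨hSP, rfl⟩ := Finset.mem_filter.mp hS
        rw [hsplit hSP]
    _ = P := by rw [Finset.sum_fiberwise, ← MvPolynomial.as_sum]

end DisjointVariables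

section TensorRank

variable {K A C D : Type*} [Field K] [AddCommGroup A] [AddCommGroup C] [AddCommGroup D]
  [Module K A] [Module K C] [Module K D]

lemma exists_shorter_sum (B : A →ₗ[K] C →ₗ[K] D) {n : ℕ} (φ : Fin (n + 1) → A)
    (ψ : Fin (n + 1) → C) (hψ : ¬ LinearIndependent K ψ) :
    ∃ (φ' : Fin n → A) (ψ' : Fin n → C), ∑ j, B (φ' j) (ψ' j) = ∑ j, B (φ j) (ψ j) := by
  obtain ⟨c, hc, i, hi⟩ := Fintype.not_linearIndependent_iff.mp hψ
  refine ⟨fun j ↦ φ (i.succAbove j) - ((c i)⁻¹ * c (i.succAbove j)) • φ i,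
    fun j ↦ ψ (i.succAbove j), ?_⟩
  have hψi : ψ i = - ∑ j, ((c i)⁻¹ * c (i.succAbove j)) • ψ (i.succAbove j) := by
    rw [Fin.sum_univ_succAbove _ i] at hc
    simp only [mul_smul, ← Finset.smul_sum]
    rw [← smul_neg, ← eq_neg_of_add_eq_zero_left hc, inv_smul_smul₀ hi]
  rw [Fin.sum_univ_succAbove (fun j ↦ B (φ j) (ψ j)) i, hψi]
  simp only [map_sub, map_smul, LinearMap.sub_apply, LinearMap.smul_apply, map_neg, map_sum,
    Finset.sum_sub_distrib]
  abel

lemma exists_linearIndependent_sum_eq (B : A →ₗ[K] C →ₗ[K] D) {n₀ : ℕ} (φ₀ : Fin n₀ → A)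
    (ψ₀ : Fin n₀ → C) : ∃ n ≤ n₀, ∃ (φ : Fin n → A) (ψ : Fin n → C),
      LinearIndependent K φ ∧ LinearIndependent K ψ ∧
        ∑ j, B (φ j) (ψ j) = ∑ j, B (φ₀ j) (ψ₀ j) := by
  induction n₀ with
  | zero =>
    exact ⟨0, le_rfl, φ₀, ψ₀, linearIndependent_empty_type, linearIndependent_empty_type, rfl⟩
  | succ n₀ ih =>
    by_cases hind : LinearIndependent K φ₀ ∧ LinearIndependent K ψ₀
    · exact ⟨n₀ + 1, le_rfl, φ₀, ψ₀, hind.1, hind.2, rfl⟩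
    have hshort : ∃ (φ' : Fin n₀ → A) (ψ' : Fin n₀ → C),
        ∑ j, B (φ' j) (ψ' j) = ∑ j, B (φ₀ j) (ψ₀ j) := by
      by_cases hψ : LinearIndependent K ψ₀
      · obtain ⟨ψ', φ', hsum⟩ := exists_shorter_sum B.flip ψ₀ φ₀ fun hφ ↦ hind ⟨hφ, hψ⟩
        exact ⟨φ', ψ', hsum⟩
      · exact exists_shorter_sum B φ₀ ψ₀ hψ
    obtain ⟨φ', ψ', hsum⟩ := hshort
    obtain ⟨n, hn, φ, ψ, hφ, hψ, hsum'⟩ := ih φ' ψ'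
    exact ⟨n, hn.trans n₀.le_succ, φ, ψ, hφ, hψ, hsum'.trans hsum⟩

end TensorRank

section WronskianOfProduct

lemma degreeOf_det_le {σ ι R : Type*} [Fintype ι] [DecidableEq ι] [CommRing R]
    {h : σ} {d : ℕ} {M : Matrix ι ι (MvPolynomial σ R)} (hM : ∀ a b, degreeOf h (M a b) ≤ d) :
    degreeOf h M.det ≤ Fintype.card ι * d := by
  rw [Matrix.det_apply]
  refine (degreeOf_sum_le ..).trans (Finset.sup_le fun τ _ ↦ ?_)
  have hsign : degreeOf h (Equiv.Perm.sign τ • ∏ i, M (τ i) i) = degreeOf h (∏ i, M (τ i) i) := by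
    rcases Int.units_eq_one_or (Equiv.Perm.sign τ) with hτ | hτ <;> simp [hτ, degreeOf_neg]
  rw [hsign]
  exact (degreeOf_prod_le ..).trans (Finset.sum_le_card_nsmul _ _ _ fun i _ ↦ hM (τ i) i)

variable {σ τ ι R : Type*} [Fintype σ] [Fintype τ] [Fintype ι] [DecidableEq ι] [CommRing R]

lemma det_hasse_sumElim (I : ι → σ →₀ ℕ) (J : ι → τ →₀ ℕ) (φ : ι → MvPolynomial σ R)
    (ψ : ι → MvPolynomial τ R) :
    (Matrix.of fun a b ↦ hasse ((I a).sumElim (J b)) (∑ j, tmul (φ j) (ψ j))).det =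
      tmul (wronskian I φ) (wronskian J ψ) := by
  have hfactor : (Matrix.of fun a b ↦ hasse ((I a).sumElim (J b)) (∑ j, tmul (φ j) (ψ j))) =
      (rename Sum.inl).mapMatrix (Matrix.of fun i j ↦ hasse (I i) (φ j)) *
        ((rename Sum.inr).mapMatrix (Matrix.of fun i j ↦ hasse (J i) (ψ j))).transpose := by
    ext1 a b
    rw [Matrix.of_apply, map_sum]
    exact Finset.sum_congr rfl fun j _ ↦ hasse_tmul ..
  rw [hfactor, Matrix.det_mul, Matrix.det_transpose, ← AlgHom.map_det, ← AlgHom.map_det]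
  rfl

end WronskianOfProduct

/-! ### Norms on coefficients -/

section Norms

variable {σ R : Type*}

section CommSemiring

variable [CommSemiring R] (v : AbsoluteValue R ℝ)

/-- The maximum of the absolute values of the coefficients of `P`, with value `0` at `P = 0`. -/
noncomputable def gaussNorm (P : MvPolynomial σ R) : ℝ := ⨆ s : P.support, v (coeff s P)

/-- The sum of the absolute values of the coefficients of `P`. -/
noncomputable def lengthNorm (P : MvPolynomial σ R) : ℝ := ∑ s ∈ P.support, v (coeff s P)

lemma gaussNorm_nonneg (P : MvPolynomial σ R) : 0 ≤ gaussNorm v P :=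
  Real.iSup_nonneg fun _ ↦ v.nonneg _

lemma lengthNorm_nonneg (P : MvPolynomial σ R) : 0 ≤ lengthNorm v P :=
  Finset.sum_nonneg fun _ _ ↦ v.nonneg _

lemma apply_coeff_le_gaussNorm (P : MvPolynomial σ R) (I : σ →₀ ℕ) :
    v (coeff I P) ≤ gaussNorm v P := by
  by_cases hI : I ∈ P.support
  · exact Finite.le_ciSup_of_le (f := fun s : P.support ↦ v (coeff s P)) ⟨I, hI⟩ le_rfl
  · rw [notMem_support_iff.mp hI, map_zero]
    exact gaussNorm_nonneg v P

variable {v} in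
lemma gaussNorm_le {P : MvPolynomial σ R} {B : ℝ} (hB : 0 ≤ B) (h : ∀ I, v (coeff I P) ≤ B) :
    gaussNorm v P ≤ B :=
  Real.iSup_le (fun s ↦ h s) hB

lemma lengthNorm_eq_sum {P : MvPolynomial σ R} {S : Finset (σ →₀ ℕ)} (hS : P.support ⊆ S) :
    lengthNorm v P = ∑ s ∈ S, v (coeff s P) :=
  Finset.sum_subset hS fun s _ hs ↦ by rw [notMem_support_iff.mp hs, map_zero]

lemma gaussNorm_le_lengthNorm (P : MvPolynomial σ R) : gaussNorm v P ≤ lengthNorm v P :=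
  Real.iSup_le (fun s ↦ Finset.single_le_sum (f := fun s ↦ v (coeff s P))
    (fun _ _ ↦ v.nonneg _) s.2) (lengthNorm_nonneg v P)

lemma lengthNorm_add_le (P Q : MvPolynomial σ R) :
    lengthNorm v (P + Q) ≤ lengthNorm v P + lengthNorm v Q := by
  classical
  rw [lengthNorm_eq_sum v (support_add (p := P) (q := Q)),
    lengthNorm_eq_sum v (Finset.subset_union_left (s₁ := P.support) (s₂ := Q.support)),
    lengthNorm_eq_sum v (Finset.subset_union_right (s₁ := P.support) (s₂ := Q.support)),
    ← Finset.sum_add_distrib]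
  exact Finset.sum_le_sum fun s _ ↦ by rw [coeff_add]; exact v.add_le _ _

lemma lengthNorm_sum_le {ι : Type*} (s : Finset ι) (f : ι → MvPolynomial σ R) :
    lengthNorm v (∑ i ∈ s, f i) ≤ ∑ i ∈ s, lengthNorm v (f i) :=
  Finset.le_sum_of_subadditive _ (by simp [lengthNorm]) (lengthNorm_add_le v) s f

lemma lengthNorm_monomial (I : σ →₀ ℕ) (c : R) : lengthNorm v (monomial I c) = v c := by
  classical
  rw [lengthNorm_eq_sum v support_monomial_subset]
  simp

lemma lengthNorm_mul_le (P Q : MvPolynomial σ R) :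
    lengthNorm v (P * Q) ≤ lengthNorm v P * lengthNorm v Q := by
  conv_lhs => rw [P.as_sum, Q.as_sum, Finset.sum_mul_sum]
  refine (lengthNorm_sum_le v _ _).trans ?_
  rw [lengthNorm, lengthNorm, Finset.sum_mul_sum]
  refine Finset.sum_le_sum fun s _ ↦ (lengthNorm_sum_le v _ _).trans ?_
  refine Finset.sum_le_sum fun t _ ↦ ?_
  rw [monomial_mul, ← map_mul, lengthNorm_monomial]

lemma lengthNorm_prod_le [Nontrivial R] {ι : Type*} (s : Finset ι) (f : ι → MvPolynomial σ R) :
    lengthNorm v (∏ i ∈ s, f i) ≤ ∏ i ∈ s, lengthNorm v (f i) := by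
  classical
  induction s using Finset.induction_on with
  | empty => simpa using (lengthNorm_monomial v (0 : σ →₀ ℕ) (1 : R)).le
  | insert i s hi ih =>
    rw [Finset.prod_insert hi, Finset.prod_insert hi]
    exact (lengthNorm_mul_le v _ _).trans
      (mul_le_mul_of_nonneg_left ih (lengthNorm_nonneg v _))

variable {v}

lemma gaussNorm_mul_le (hv : IsNonarchimedean v) (P Q : MvPolynomial σ R) :
    gaussNorm v (P * Q) ≤ gaussNorm v P * gaussNorm v Q := by
  classical
  have h0 := mul_nonneg (gaussNorm_nonneg v P) (gaussNorm_nonneg v Q)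
  refine gaussNorm_le h0 fun I ↦ ?_
  rw [coeff_mul]
  refine hv.apply_sum_le.trans (Real.iSup_le (fun x ↦ ?_) h0)
  rw [map_mul]
  exact mul_le_mul (apply_coeff_le_gaussNorm v P _) (apply_coeff_le_gaussNorm v Q _)
    (v.nonneg _) (gaussNorm_nonneg v P)

lemma gaussNorm_prod_le [Nontrivial R] (hv : IsNonarchimedean v) {ι : Type*} (s : Finset ι)
    (f : ι → MvPolynomial σ R) :
    gaussNorm v (∏ i ∈ s, f i) ≤ ∏ i ∈ s, gaussNorm v (f i) := by
  classical
  induction s using Finset.induction_on with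
  | empty =>
    simpa using (gaussNorm_le_lengthNorm v 1).trans (lengthNorm_monomial v (0 : σ →₀ ℕ) (1 : R)).le
  | insert i s hi ih =>
    rw [Finset.prod_insert hi, Finset.prod_insert hi]
    exact (gaussNorm_mul_le hv _ _).trans
      (mul_le_mul_of_nonneg_left ih (gaussNorm_nonneg v _))

end CommSemiring

section Det

variable {ι : Type*} [Fintype ι] [DecidableEq ι] [CommRing R] [Nontrivial R]
  {v : AbsoluteValue R ℝ} {M : Matrix ι ι (MvPolynomial σ R)} {B : ℝ}

lemma lengthNorm_det_le (hM : ∀ a b, lengthNorm v (M a b) ≤ B) :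
    lengthNorm v M.det ≤ (Fintype.card ι).factorial * B ^ Fintype.card ι := by
  have hsign (π : Equiv.Perm ι) (f : MvPolynomial σ R) :
      lengthNorm v (π.sign • f) = lengthNorm v f := by
    rcases Int.units_eq_one_or π.sign with h | h <;> simp [h, lengthNorm]
  rw [Matrix.det_apply]
  calc lengthNorm v (∑ π : Equiv.Perm ι, π.sign • ∏ i, M (π i) i)
      ≤ ∑ π : Equiv.Perm ι, lengthNorm v (∏ i, M (π i) i) :=
        (lengthNorm_sum_le v univ _).trans_eq (Finset.sum_congr rfl fun π _ ↦ hsign π _)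
    _ ≤ ∑ π : Equiv.Perm ι, ∏ i, lengthNorm v (M (π i) i) :=
        Finset.sum_le_sum fun π _ ↦ lengthNorm_prod_le v _ _
    _ ≤ ∑ _π : Equiv.Perm ι, ∏ _i : ι, B :=
        Finset.sum_le_sum fun π _ ↦
          Finset.prod_le_prod (fun _ _ ↦ lengthNorm_nonneg v _) fun i _ ↦ hM (π i) i
    _ = (Fintype.card ι).factorial * B ^ Fintype.card ι := by simp [Fintype.card_perm]

lemma gaussNorm_det_le (hv : IsNonarchimedean v) (hB : 0 ≤ B)
    (hM : ∀ a b, gaussNorm v (M a b) ≤ B) : gaussNorm v M.det ≤ B ^ Fintype.card ι := by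
  have h0 : 0 ≤ B ^ Fintype.card ι := pow_nonneg hB _
  refine gaussNorm_le h0 fun I ↦ ?_
  rw [Matrix.det_apply, coeff_sum]
  refine hv.apply_sum_le.trans (Real.iSup_le (fun π ↦ ?_) h0)
  rw [coeff_smul, v.map_units_int_smul]
  calc v (coeff I (∏ i, M (π.1 i) i))
      ≤ gaussNorm v (∏ i, M (π.1 i) i) := apply_coeff_le_gaussNorm v _ I
    _ ≤ ∏ i, gaussNorm v (M (π.1 i) i) := gaussNorm_prod_le hv _ _
    _ ≤ ∏ _i : ι, B := Finset.prod_le_prod (fun _ _ ↦ gaussNorm_nonneg v _) fun i _ ↦ hM _ _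
    _ = B ^ Fintype.card ι := by simp

end Det

end Norms

section HasseNorm

lemma sum_range_choose_le_two_pow (r i : ℕ) : ∑ s ∈ range (r + 1), s.choose i ≤ 2 ^ r := by
  induction r with
  | zero => simpa using Nat.choose_le_two_pow 0 i
  | succ r ih =>
    rw [Finset.sum_range_succ, pow_succ]
    have := Nat.choose_succ_le_two_pow r i
    omega

variable {σ R : Type*} [Fintype σ] [CommSemiring R]

lemma sum_support_hasse_prod_choose_le (I : σ →₀ ℕ) {P : MvPolynomial σ R} {r : σ → ℕ}
    (hr : ∀ h, P.degreeOf h ≤ r h) :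
    ∑ J ∈ (hasse I P).support, ∏ h, (J h + I h).choose (I h) ≤ 2 ^ ∑ h, r h := by
  classical
  calc ∑ J ∈ (hasse I P).support, ∏ h, (J h + I h).choose (I h)
      = ∑ S ∈ (hasse I P).support.image (fun J ↦ ⇑(J + I)), ∏ h, (S h).choose (I h) :=
        (Finset.sum_image (f := fun S : σ → ℕ ↦ ∏ h, (S h).choose (I h))
          (DFunLike.coe_injective.comp (add_left_injective I)).injOn).symm
    _ ≤ ∑ S ∈ Fintype.piFinset fun h ↦ range (r h + 1), ∏ h, (S h).choose (I h) := by
        refine Finset.sum_le_sum_of_subset fun S hS ↦ ?_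
        obtain ⟨J, hJ, rfl⟩ := Finset.mem_image.mp hS
        rw [mem_support_iff, coeff_hasse] at hJ
        refine Fintype.mem_piFinset.mpr fun h ↦ mem_range.mpr (Nat.lt_succ_of_le ?_)
        exact degreeOf_le_iff.mp (hr h) (J + I) (mem_support_iff.mpr (right_ne_zero_of_mul hJ))
    _ = ∏ h, ∑ s ∈ range (r h + 1), s.choose (I h) :=
        (Finset.prod_univ_sum (fun h ↦ range (r h + 1)) fun h s ↦ s.choose (I h)).symm
    _ ≤ ∏ h, 2 ^ r h := Finset.prod_le_prod' fun h _ ↦ sum_range_choose_le_two_pow (r h) (I h)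
    _ = 2 ^ ∑ h, r h := Finset.prod_pow_eq_pow_sum _ _ _

lemma lengthNorm_hasse_le (v : AbsoluteValue R ℝ) (I : σ →₀ ℕ) {P : MvPolynomial σ R} {r : σ → ℕ}
    (hr : ∀ h, P.degreeOf h ≤ r h) :
    lengthNorm v (hasse I P) ≤ 2 ^ (∑ h, r h) * gaussNorm v P := by
  calc lengthNorm v (hasse I P)
      ≤ ∑ J ∈ (hasse I P).support, (∏ h, ((J h + I h).choose (I h) : ℝ)) * gaussNorm v P := by
        refine Finset.sum_le_sum fun J _ ↦ ?_
        rw [coeff_hasse, map_mul, ← Nat.cast_prod, ← Nat.cast_prod]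
        exact mul_le_mul (v.apply_nat_le_self _) (apply_coeff_le_gaussNorm v P _) (v.nonneg _)
          (Nat.cast_nonneg _)
    _ ≤ 2 ^ (∑ h, r h) * gaussNorm v P := by
        rw [← Finset.sum_mul]
        refine mul_le_mul_of_nonneg_right ?_ (gaussNorm_nonneg v P)
        exact_mod_cast sum_support_hasse_prod_choose_le I hr

lemma gaussNorm_hasse_le [Nontrivial R] {v : AbsoluteValue R ℝ} (hv : IsNonarchimedean v)
    (I : σ →₀ ℕ) (P : MvPolynomial σ R) : gaussNorm v (hasse I P) ≤ gaussNorm v P := by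
  refine gaussNorm_le (gaussNorm_nonneg v P) fun J ↦ ?_
  rw [coeff_hasse, map_mul, ← Nat.cast_prod]
  exact (mul_le_of_le_one_left (v.nonneg _) hv.apply_natCast_le_one).trans
    (apply_coeff_le_gaussNorm v P _)

end HasseNorm

/-! ### Heights of polynomials -/

section CoeffHeight

open AdmissibleAbsValues

variable {σ τ K : Type*} [Field K]

lemma coeff_support_ne_zero {P : MvPolynomial σ K} (hP : P ≠ 0) :
    (fun s : P.support ↦ coeff s P) ≠ 0 := by
  obtain ⟨s, hs⟩ := support_nonempty.mpr hP
  exact Function.ne_iff.mpr ⟨⟨s, hs⟩, mem_support_iff.mp hs⟩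

variable [AdmissibleAbsValues K]

/-- The logarithmic height of the family of nonzero coefficients of a polynomial over `K`. Like
`Height.logHeight`, it is relative to `K`: for a number field `K` it is `[K : ℚ]` times the
absolute height. -/
noncomputable def coeffHeight (P : MvPolynomial σ K) : ℝ :=
  logHeight fun s : P.support ↦ coeff s P

lemma coeffHeight_nonneg (P : MvPolynomial σ K) : 0 ≤ coeffHeight P := logHeight_nonneg _

lemma coeffHeight_add_le_tmul {f : MvPolynomial σ K} {g : MvPolynomial τ K} (hf : f ≠ 0)
    (hg : g ≠ 0) : coeffHeight f + coeffHeight g ≤ coeffHeight (tmul f g) := by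
  have hmem (a : f.support × g.support) :
      Finsupp.sumElim (a.1 : σ →₀ ℕ) (a.2 : τ →₀ ℕ) ∈ (tmul f g).support := by
    rw [mem_support_iff, coeff_tmul]
    exact mul_ne_zero (mem_support_iff.mp a.1.2) (mem_support_iff.mp a.2.2)
  calc coeffHeight f + coeffHeight g
      = logHeight fun a : f.support × g.support ↦ coeff a.1 f * coeff a.2 g :=
        (logHeight_fun_mul_eq (coeff_support_ne_zero hf) (coeff_support_ne_zero hg)).symm
    _ = logHeight ((fun s : (tmul f g).support ↦ coeff s (tmul f g)) ∘ fun a ↦ ⟨_, hmem a⟩) :=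
        congrArg logHeight (funext fun a ↦ (coeff_tmul f g a.1 a.2).symm)
    _ ≤ coeffHeight (tmul f g) := logHeight_comp_le _ _

lemma coeffHeight_rename_le {e : σ → τ} (he : Function.Injective e) (P : MvPolynomial σ K) :
    coeffHeight (rename e P) ≤ coeffHeight P := by
  choose u hu hu0 using fun s : (rename e P).support ↦
    coeff_rename_ne_zero e P s (mem_support_iff.mp s.2)
  have hcoeff (s : (rename e P).support) : coeff s (rename e P) = coeff (u s) P := by
    rw [← hu s, coeff_rename_mapDomain e he]
  calc coeffHeight (rename e P)
      = logHeight ((fun s : P.support ↦ coeff s P) ∘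
          fun s ↦ ⟨u s, mem_support_iff.mpr (hu0 s)⟩) := congrArg logHeight (funext hcoeff)
    _ ≤ coeffHeight P := logHeight_comp_le _ _

theorem coeffHeight_det_hasse_le [Fintype σ] {ι : Type*} [Fintype ι] [DecidableEq ι]
    {P : MvPolynomial σ K} (hP : P ≠ 0) {r : σ → ℕ} (hr : ∀ h, P.degreeOf h ≤ r h)
    {I : ι → ι → σ →₀ ℕ} (hdet : (Matrix.of fun a b ↦ hasse (I a b) P).det ≠ 0) :
    coeffHeight (Matrix.of fun a b ↦ hasse (I a b) P).det ≤ Fintype.card ι * coeffHeight P +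
      totalWeight K *
        Real.log ((Fintype.card ι).factorial * (2 ^ ∑ h, r h) ^ Fintype.card ι) := by
  refine logHeight_le_of_local (coeff_support_ne_zero hP) (coeff_support_ne_zero hdet)
    (by positivity) _ (fun v _ ↦ ?_) fun v hv ↦ ?_
  · calc gaussNorm v (Matrix.of fun a b ↦ hasse (I a b) P).det
        ≤ (Fintype.card ι).factorial * (2 ^ (∑ h, r h) * gaussNorm v P) ^ Fintype.card ι :=
          (gaussNorm_le_lengthNorm v _).trans
            (lengthNorm_det_le fun a b ↦ lengthNorm_hasse_le v (I a b) hr)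
      _ = (Fintype.card ι).factorial * (2 ^ ∑ h, r h) ^ Fintype.card ι *
            gaussNorm v P ^ Fintype.card ι := by ring
  · have hv' := AdmissibleAbsValues.isNonarchimedean v hv
    exact gaussNorm_det_le hv' (gaussNorm_nonneg v P) fun a b ↦ gaussNorm_hasse_le hv' (I a b) P

end CoeffHeight

section Univariate

open AdmissibleAbsValues

variable {σ R : Type*} [Unique σ]

lemma natDegree_uniqueAlgEquiv_le [CommSemiring R] (f : MvPolynomial σ R) :
    (uniqueAlgEquiv R σ f).natDegree ≤ f.degreeOf default := by
  refine Polynomial.natDegree_le_iff_coeff_eq_zero.mpr fun n hn ↦ ?_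
  rw [coeff_uniqueAlgEquiv]
  by_contra h
  have := (degreeOf_le_iff (n := default)).mp le_rfl _ (mem_support_iff.mpr h)
  rw [Finsupp.single_eq_same] at this
  omega

lemma uniqueAlgEquiv_translate [CommRing R] (β : σ → R) (f : MvPolynomial σ R) :
    uniqueAlgEquiv R σ (translate β f) =
      (uniqueAlgEquiv R σ f).comp (Polynomial.X + Polynomial.C (β default)) := by
  have h : (uniqueAlgEquiv R σ).toAlgHom.comp (translate β) =
      (Polynomial.aeval (Polynomial.X + Polynomial.C (β default))).comp
        (uniqueAlgEquiv R σ).toAlgHom := by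
    ext x
    rw [Unique.eq_default x]
    simp [translate]
  exact DFunLike.congr_fun h f

lemma coeff_rootMultiplicity_translate_ne_zero [CommRing R] [IsDomain R] {f : MvPolynomial σ R}
    (hf : f ≠ 0) (β : σ → R) :
    coeff (Finsupp.single default ((uniqueAlgEquiv R σ f).rootMultiplicity (β default)))
      (translate β f) ≠ 0 := by
  rw [← coeff_uniqueAlgEquiv, Polynomial.rootMultiplicity_eq_natTrailingDegree,
    ← uniqueAlgEquiv_translate, Polynomial.coeff_natTrailingDegree_ne_zero]
  exact (map_ne_zero_iff _ (uniqueAlgEquiv R σ).injective).mpr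
    ((map_ne_zero_iff _ (translate_injective β)).mpr hf)

theorem exists_coeff_translate_ne_zero_mul_logHeight₁_le {K : Type*} [Field K]
    [AdmissibleAbsValues K] {f : MvPolynomial σ K} (hf : f ≠ 0) (β : σ → K) :
    ∃ J, coeff J (translate β f) ≠ 0 ∧
      J default * logHeight₁ (β default) ≤
        coeffHeight f + totalWeight K * (f.degreeOf default * Real.log 2) := by
  set p := uniqueAlgEquiv K σ f
  have hp : p ≠ 0 := (map_ne_zero_iff _ (uniqueAlgEquiv K σ).injective).mpr hf
  refine ⟨_, coeff_rootMultiplicity_translate_ne_zero hf β, ?_⟩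
  have hmem (s : p.support) : Finsupp.single default (s : ℕ) ∈ f.support := by
    rw [mem_support_iff, ← coeff_uniqueAlgEquiv]
    exact Polynomial.mem_support_iff.mp s.2
  calc _ = p.rootMultiplicity (β default) * logHeight₁ (β default) := by
        rw [Finsupp.single_eq_same]
    _ ≤ logHeight (fun s : p.support ↦ p.coeff s) + totalWeight K * (p.natDegree * Real.log 2) :=
        mul_logHeight₁_le_of_pow_X_sub_C_dvd hp (p.pow_rootMultiplicity_dvd _)
    _ = logHeight ((fun s : f.support ↦ coeff s f) ∘ fun s : p.support ↦ ⟨_, hmem s⟩) +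
          totalWeight K * (p.natDegree * Real.log 2) := by
        congr 2
        exact funext fun s ↦ coeff_uniqueAlgEquiv K f s
    _ ≤ _ := by
        gcongr
        · exact logHeight_comp_le _ _
        · exact natDegree_uniqueAlgEquiv_le f

end Univariate

/-! ### Real inequalities -/

section Inequalities

lemma sum_range_sub_mul (θ c : ℝ) (N : ℕ) :
    ∑ a ∈ range N, (θ - a * c) = N * (θ - (N - 1) / 2 * c) := by
  induction N with
  | zero => simp
  | succ N ih =>
    rw [Finset.sum_range_succ, ih]
    push_cast
    ring

lemma mul_half_le_sum_max {θ c : ℝ} {N n : ℕ} (hN : (N - 1) * c ≤ θ) (hNn : N ≤ n) :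
    N * (θ / 2) ≤ ∑ a ∈ range n, max (θ - a * c) 0 :=
  calc N * (θ / 2) ≤ N * (θ - (N - 1) / 2 * c) :=
        mul_le_mul_of_nonneg_left (by linarith) (Nat.cast_nonneg _)
    _ = ∑ a ∈ range N, (θ - a * c) := (sum_range_sub_mul θ c N).symm
    _ ≤ ∑ a ∈ range N, max (θ - a * c) 0 := Finset.sum_le_sum fun a _ ↦ le_max_left _ _
    _ ≤ ∑ a ∈ range n, max (θ - a * c) 0 :=
        Finset.sum_le_sum_of_subset_of_nonneg (Finset.range_mono hNn) fun _ _ _ ↦ le_max_right _ _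

lemma mul_min_le_sum_max {θ c : ℝ} (hθ : 0 ≤ θ) (hc : 0 < c) {n : ℕ} (hn : n * c ≤ 2) :
    n * min (θ / 2) (θ ^ 2 / 4) ≤ ∑ a ∈ range n, max (θ - a * c) 0 := by
  have hfloor : ⌊θ / c⌋₊ * c ≤ θ := (le_div_iff₀ hc).mp (Nat.floor_le (by positivity))
  rcases le_or_gt n (⌊θ / c⌋₊ + 1) with hle | hlt
  · have hn1 : ((n : ℝ) - 1) * c ≤ θ := by
      have : (n : ℝ) ≤ ⌊θ / c⌋₊ + 1 := by exact_mod_cast hle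
      exact (mul_le_mul_of_nonneg_right (by linarith) hc.le).trans hfloor
    exact (mul_le_mul_of_nonneg_left (min_le_left _ _) (Nat.cast_nonneg _)).trans
      (mul_half_le_sum_max hn1 le_rfl)
  · calc (n : ℝ) * min (θ / 2) (θ ^ 2 / 4) ≤ n * (θ ^ 2 / 4) :=
          mul_le_mul_of_nonneg_left (min_le_right _ _) (Nat.cast_nonneg _)
      _ = n * c * (θ / c) / 2 * (θ / 2) := by field_simp; ring
      _ ≤ 2 * (θ / c) / 2 * (θ / 2) := by gcongr
      _ = θ / c * (θ / 2) := by ring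
      _ ≤ (⌊θ / c⌋₊ + 1 : ℕ) * (θ / 2) := by
          push_cast
          gcongr
          exact (Nat.lt_floor_add_one _).le
      _ ≤ _ := mul_half_le_sum_max (by push_cast; linarith) hlt.le

lemma le_of_sum_max_le {θ c η M : ℝ} (hη0 : 0 < η) (hη : η ≤ 1 / 2) (hM : 2 ≤ M) (hc : 0 < c)
    {n : ℕ} (hn0 : 0 < n) (hn : n * c ≤ 2)
    (h : ∑ a ∈ range n, max (θ - a * c) 0 ≤ n * (2 * M * η ^ 2)) : θ ≤ 2 * M * η := by
  by_contra! hθ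
  have hMη : 0 < M * η := by positivity
  have hmin : min (θ / 2) (θ ^ 2 / 4) ≤ 2 * M * η ^ 2 :=
    le_of_mul_le_mul_left ((mul_min_le_sum_max (by linarith) hc hn).trans h) (by exact_mod_cast hn0)
  have hlinear : 2 * M * η ^ 2 < θ / 2 :=
    calc 2 * M * η ^ 2 = M * η * (2 * η) := by ring
      _ ≤ M * η * 1 := mul_le_mul_of_nonneg_left (by linarith) hMη.le
      _ < θ / 2 := by linarith
  have hquadratic : 2 * M * η ^ 2 < θ ^ 2 / 4 :=
    calc 2 * M * η ^ 2 ≤ M * M * η ^ 2 := by gcongr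
      _ = (2 * M * η) ^ 2 / 4 := by ring
      _ < θ ^ 2 / 4 := by gcongr
  exact (lt_min hlinear hquadratic).not_ge hmin

lemma log_factorial_mul_pow_le {n ρ : ℕ} (hn : n ≤ ρ + 1) (S : ℕ) :
    Real.log (n.factorial * (2 ^ S) ^ n) ≤ n * ((ρ + S) * Real.log 2) := by
  have hfactorial : n.factorial ≤ (2 ^ ρ) ^ n :=
    (Nat.factorial_le_pow n).trans (Nat.pow_le_pow_left (hn.trans Nat.lt_two_pow_self) n)
  calc Real.log (n.factorial * (2 ^ S) ^ n)
      ≤ Real.log ((2 ^ ρ) ^ n * (2 ^ S) ^ n) := by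
        gcongr
        exact_mod_cast hfactorial
    _ = n * ((ρ + S) * Real.log 2) := by
        rw [← mul_pow, ← pow_add, Real.log_pow, Real.log_pow, Nat.cast_add]

end Inequalities

/-! ### Separating the last variable -/

section Separation

lemma weight_le_mul {σ : Type*} {w : σ → ℝ} {c : ℝ} {I : σ →₀ ℕ} {d : ℕ} (hc : 0 ≤ c)
    (hw : ∀ h, w h ≤ c) (hI : I.degree ≤ d) : Finsupp.weight w I ≤ d * c :=
  calc Finsupp.weight w I = ∑ h ∈ I.support, I h • w h := Finsupp.weight_apply ..
    _ ≤ ∑ h ∈ I.support, I h • c := Finset.sum_le_sum fun h _ ↦ nsmul_le_nsmul_right (hw h) _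
    _ = I.degree • c := (Finset.sum_nsmul_assoc ..).trans rfl
    _ ≤ d * c := by
      rw [nsmul_eq_mul]
      gcongr

lemma WeightedOrderGE.rename {σ τ R : Type*} [CommSemiring R] {w : τ → ℝ} {t : ℝ} (e : σ → τ)
    {f : MvPolynomial σ R} (hf : WeightedOrderGE (w ∘ e) t f) :
    WeightedOrderGE w t (rename e f) := by
  intro I hI
  obtain ⟨J, rfl, hJ⟩ := coeff_rename_ne_zero e f I hI
  refine (hf J hJ).trans_eq ?_
  rw [Finsupp.weight_apply, Finsupp.weight_apply, Finsupp.sum_mapDomain_index (by simp)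
    (fun _ _ _ ↦ add_smul ..)]
  rfl

lemma weightedOrderGE_translate_det_hasse {σ ι R : Type*} [Fintype σ] [Fintype ι] [DecidableEq ι]
    [CommRing R] [IsDomain R] [CharZero R] {w : σ → ℝ} {t : ℝ} {u : ι → ℝ} {β : σ → R}
    {P : MvPolynomial σ R} {I : ι → ι → σ →₀ ℕ} (hw : ∀ h, 0 ≤ w h)
    (hI : ∀ a b, Finsupp.weight w (I a b) ≤ u b) (hP : WeightedOrderGE w t (translate β P)) :
    WeightedOrderGE w (∑ b, max (t - u b) 0)
      (translate β (Matrix.of fun a b ↦ hasse (I a b) P).det) := by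
  rw [AlgHom.map_det]
  refine WeightedOrderGE.det fun a b ↦ ?_
  rw [AlgHom.mapMatrix_apply, Matrix.map_apply, Matrix.of_apply, ← hasse_translate]
  exact (hP.hasse hw (I a b)).mono (max_le_max (by linarith [hI a b]) le_rfl)

lemma exists_det_hasse_eq_tmul {K σ τ : Type*} [Field K] [CharZero K] [Fintype σ] [Fintype τ]
    [Unique τ] {P : MvPolynomial (σ ⊕ τ) K} (hP : P ≠ 0) {d : ℕ}
    (hd : P.degreeOf (Sum.inr default) ≤ d) :
    ∃ n, 0 < n ∧ n ≤ d + 1 ∧ ∃ (I : Fin n → σ →₀ ℕ) (J : Fin n → τ →₀ ℕ)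
      (U : MvPolynomial σ K) (V : MvPolynomial τ K), (∀ a, (I a).degree ≤ d) ∧
      (∀ b, (J b).degree ≤ b) ∧ U ≠ 0 ∧ V ≠ 0 ∧
      (Matrix.of fun a b ↦ hasse ((I a).sumElim (J b)) P).det = tmul U V := by
  obtain ⟨φ₀, ψ₀, rfl⟩ := exists_sum_tmul_eq P hd
  obtain ⟨n, hn, φ, ψ, hφ, hψ, hsum⟩ := exists_linearIndependent_sum_eq tmul φ₀ ψ₀
  rw [← hsum] at hP ⊢
  have hn0 : 0 < n := Nat.pos_of_ne_zero fun h0 ↦ hP (by subst h0; exact Fin.sum_univ_zero _)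
  obtain ⟨I, hI, hU⟩ := exists_wronskian_ne_zero hφ
  obtain ⟨J, hJ, hV⟩ := exists_wronskian_ne_zero hψ
  exact ⟨n, hn0, hn, I, J, _, _, fun a ↦ (hI a).trans (by omega), hJ, hU, hV,
    det_hasse_sumElim I J φ ψ⟩

lemma sum_max_le_weight_add_weight {R σ τ : Type*} [CommRing R] [IsDomain R] [CharZero R]
    [Fintype σ] [Fintype τ] {P : MvPolynomial (σ ⊕ τ) R} {U : MvPolynomial σ R}
    {V : MvPolynomial τ R} {n d : ℕ} {I : Fin n → σ →₀ ℕ} {J : Fin n → τ →₀ ℕ}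
    (hI : ∀ a, (I a).degree ≤ d) (hJ : ∀ b, (J b).degree ≤ b)
    (hdet : (Matrix.of fun a b ↦ hasse ((I a).sumElim (J b)) P).det = tmul U V)
    {w : σ ⊕ τ → ℝ} {β : σ ⊕ τ → R} {t c c' : ℝ} (hw : ∀ h, 0 ≤ w h) (hc0 : 0 ≤ c)
    (hc : ∀ h, w (Sum.inl h) ≤ c) (hc0' : 0 ≤ c') (hc' : ∀ h, w (Sum.inr h) ≤ c')
    (hP : WeightedOrderGE w t (translate β P))
    {A : σ →₀ ℕ} (hA : coeff A (translate (β ∘ Sum.inl) U) ≠ 0)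
    {B : τ →₀ ℕ} (hB : coeff B (translate (β ∘ Sum.inr) V) ≠ 0) :
    ∑ b ∈ range n, max (t - (d * c + b * c')) 0 ≤
      Finsupp.weight (w ∘ Sum.inl) A + Finsupp.weight (w ∘ Sum.inr) B := by
  have hweight (a b : Fin n) : Finsupp.weight w ((I a).sumElim (J b)) ≤ d * c + b * c' := by
    rw [weight_sumElim]
    exact add_le_add (weight_le_mul hc0 hc (hI a)) (weight_le_mul hc0' hc' (hJ b))
  have hUV := weightedOrderGE_translate_det_hasse hw hweight hP
  rw [hdet, translate_tmul] at hUV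
  rw [Finset.sum_range, ← weight_sumElim]
  exact hUV _ (by rw [coeff_tmul]; exact mul_ne_zero hA hB)

variable {K : Type*} [Field K] [AdmissibleAbsValues K] {m : ℕ}

/-- The output of Roth's Wronskian construction, which reduces the number of variables of `P`: `U`
and `V` are nonzero polynomials in the first variables and in the last variable of `P`, and `U * V`
is a determinant of size `n` whose entries are derivatives of `P`. So its degrees and its height are
at most about `n` times those of `P`, and it vanishes to high order wherever `P` does. -/
structure IsSeparation (P : MvPolynomial (Fin (m + 1)) K) (r : Fin (m + 1) → ℕ) (n : ℕ)
    (U : MvPolynomial (Fin m) K) (V : MvPolynomial (Fin 1) K) : Prop where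
  pos : 0 < n
  le : n ≤ r (Fin.last m) + 1
  left_ne_zero : U ≠ 0
  right_ne_zero : V ≠ 0
  degreeOf_left_le (h : Fin m) : U.degreeOf h ≤ n * r h.castSucc
  degreeOf_right_le (h : Fin 1) : V.degreeOf h ≤ n * r (Fin.last m)
  coeffHeight_le : coeffHeight U + coeffHeight V ≤ n * coeffHeight P +
    totalWeight K * Real.log (n.factorial * (2 ^ ∑ h, r h) ^ n)
  sum_max_le {w : Fin (m + 1) → ℝ} {β : Fin (m + 1) → K} {t c : ℝ} (hw : ∀ h, 0 ≤ w h)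
    (hc : ∀ h : Fin m, w h.castSucc ≤ c) (hc0 : 0 ≤ c) (hP : WeightedOrderGE w t (translate β P))
    {A : Fin m →₀ ℕ} (hA : coeff A (translate (fun h ↦ β h.castSucc) U) ≠ 0)
    {B : Fin 1 →₀ ℕ} (hB : coeff B (translate (fun _ ↦ β (Fin.last m)) V) ≠ 0) :
    ∑ b ∈ range n, max (t - (r (Fin.last m) * c + b * w (Fin.last m))) 0 ≤
      Finsupp.weight (fun h ↦ w h.castSucc) A + B 0 * w (Fin.last m)

lemma exists_isSeparation [CharZero K] {P : MvPolynomial (Fin (m + 1)) K} {r : Fin (m + 1) → ℕ}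
    (hP : P ≠ 0) (hr : ∀ h, P.degreeOf h ≤ r h) : ∃ n U V, IsSeparation P r n U V := by
  let e : Fin m ⊕ Fin 1 ≃ Fin (m + 1) := finSumFinEquiv
  have hinr (h : Fin 1) : e (Sum.inr h) = Fin.last m := by
    rw [Unique.eq_default h]
    rfl
  have hP' : rename e.symm P ≠ 0 := by
    simpa using (rename_injective _ e.symm.injective).ne hP
  have hr' (h : Fin m ⊕ Fin 1) : (rename e.symm P).degreeOf h ≤ r (e h) := by
    have hdeg := degreeOf_rename_of_injective (p := P) e.symm.injective (e h)
    rw [e.symm_apply_apply] at hdeg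
    exact hdeg.trans_le (hr (e h))
  obtain ⟨n, hn0, hn, I, J, U, V, hI, hJ, hU, hV, hdet⟩ :=
    exists_det_hasse_eq_tmul hP' (hr' (Sum.inr default))
  have hdeg (h : Fin m ⊕ Fin 1) : degreeOf h (tmul U V) ≤ n * r (e h) := by
    rw [← hdet]
    exact (degreeOf_det_le fun a b ↦ (degreeOf_hasse_le ..).trans (hr' h)).trans_eq
      (by rw [Fintype.card_fin])
  refine ⟨n, U, V, hn0, hn, hU, hV, fun h ↦ ?_, fun h ↦ ?_, ?_, ?_⟩
  · exact (degreeOf_le_degreeOf_tmul_inl hU hV h).trans (hdeg _)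
  · exact (degreeOf_le_degreeOf_tmul_inr hU hV h).trans ((hdeg _).trans_eq (by rw [hinr]))
  · have hheight := coeffHeight_det_hasse_le hP' hr' (hdet.trans_ne (tmul_ne_zero hU hV))
    rw [hdet, Fintype.card_fin, e.sum_comp r] at hheight
    refine (coeffHeight_add_le_tmul hU hV).trans (hheight.trans ?_)
    gcongr
    exact coeffHeight_rename_le e.symm.injective P
  · intro w β t c hw hc hc0 hPt A hA B hB
    have hPt' : WeightedOrderGE (w ∘ e) t (translate (β ∘ e) (rename e.symm P)) := by
      rw [translate_rename]
      simpa [Function.comp_assoc] using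
        WeightedOrderGE.rename (w := w ∘ e) e.symm (by simpa [Function.comp_assoc] using hPt)
    have hle := sum_max_le_weight_add_weight hI hJ hdet (fun h ↦ hw _) hc0 hc (hw (Fin.last m))
      (fun h ↦ (congrArg w (hinr h)).le) hPt' hA (by simpa only [Function.comp_def, hinr] using hB)
    refine hle.trans_eq (congrArg₂ _ rfl ?_)
    simp [Finsupp.weight_apply, Finsupp.sum_fintype, hinr]

end Separation

/-! ### The induction on the number of variables -/

section Induction

lemma one_sub_mul_sum_le {m : ℕ} {f : Fin (m + 1) → ℝ} {s : ℝ} (hs : 0 ≤ s) (hf : ∀ h, 0 ≤ f h)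
    (hfs : ∀ j : Fin m, f j.succ ≤ s * f j.castSucc) : (1 - s) * ∑ h, f h ≤ f 0 := by
  have htail : ∑ j : Fin m, f j.succ ≤ s * ∑ h, f h :=
    calc ∑ j : Fin m, f j.succ ≤ ∑ j : Fin m, s * f j.castSucc := Finset.sum_le_sum fun j _ ↦ hfs j
      _ = s * ∑ j : Fin m, f j.castSucc := (Finset.mul_sum ..).symm
      _ ≤ s * ∑ h, f h := by
        rw [Fin.sum_univ_castSucc f]
        gcongr
        exact le_add_of_nonneg_right (hf _)
  linarith [Fin.sum_univ_succ f]

variable {K : Type*} [Field K] [AdmissibleAbsValues K]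

lemma exists_coeff_translate_ne_zero_le [CharZero K] {f : MvPolynomial (Fin 1) K} (hf : f ≠ 0)
    {d : ℕ} (hd : f.degreeOf 0 ≤ d) {β : Fin 1 → K} {B : ℝ} (hβ : 0 < logHeight₁ (β 0))
    (hB : coeffHeight f + d * totalWeight K ≤ B * logHeight₁ (β 0)) :
    ∃ J, coeff J (translate β f) ≠ 0 ∧ J 0 ≤ B := by
  obtain ⟨J, hJ, hle⟩ := exists_coeff_translate_ne_zero_mul_logHeight₁_le hf β
  refine ⟨J, hJ, le_of_mul_le_mul_right (hle.trans (le_trans ?_ hB)) hβ⟩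
  have hdeg : (f.degreeOf 0 : ℝ) * Real.log 2 ≤ d * 1 := by
    gcongr
    linarith [Real.log_two_lt_d9]
  rw [mul_one] at hdeg
  rw [mul_comm (d : ℝ)]
  gcongr
  exact hdeg

variable {m : ℕ}

/-- The hypotheses of Roth's lemma in terms of `s = η ^ 2 ^ (m - 1)`, in `m + 1` rather than `m`
variables and over a field with a product formula. Heights are not normalized by the degree of a
number field here, which brings in the factor `totalWeight K`. -/
structure RothHypotheses (P : MvPolynomial (Fin (m + 1)) K) (r : Fin (m + 1) → ℕ)
    (β : Fin (m + 1) → K) (s : ℝ) : Prop where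
  ne_zero : P ≠ 0
  pos (h) : 0 < r h
  degreeOf_le (h) : P.degreeOf h ≤ r h
  ratio_le (j : Fin m) : (r j.succ : ℝ) ≤ s * r j.castSucc
  height_le (h) : coeffHeight P + 2 * (m + 1) * r 0 * totalWeight K ≤ s * (r h * logHeight₁ (β h))

namespace RothHypotheses

variable {s : ℝ}

section

variable {P : MvPolynomial (Fin (m + 1)) K} {r : Fin (m + 1) → ℕ} {β : Fin (m + 1) → K}

lemma antitone (H : RothHypotheses P r β s) (hs : s ≤ 1) : Antitone r :=
  Fin.antitone_iff_succ_le.mpr fun j ↦ by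
    exact_mod_cast (H.ratio_le j).trans (mul_le_of_le_one_left (Nat.cast_nonneg _) hs)

lemma logHeight₁_pos (H : RothHypotheses P r β s) (hT : 0 < totalWeight K) (hs : 0 ≤ s)
    (h : Fin (m + 1)) : 0 < logHeight₁ (β h) := by
  have hr0 := H.pos 0
  have hP := coeffHeight_nonneg P
  have hprod : 0 < s * r h * logHeight₁ (β h) := by
    rw [mul_assoc]
    refine lt_of_lt_of_le ?_ (H.height_le h)
    positivity
  exact pos_of_mul_pos_right hprod (by positivity)

end

section

variable {P : MvPolynomial (Fin (m + 1 + 1)) K} {r : Fin (m + 1 + 1) → ℕ}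
  {β : Fin (m + 1 + 1) → K} {n : ℕ} {U : MvPolynomial (Fin (m + 1)) K} {V : MvPolynomial (Fin 1) K}

lemma last_le (H : RothHypotheses P r β s) (hs0 : 0 ≤ s) (hs : s ≤ 1) (h : Fin (m + 1)) :
    (r (Fin.last (m + 1)) : ℝ) ≤ s * r h.castSucc :=
  (H.ratio_le (Fin.last m)).trans <| by
    gcongr
    exact H.antitone hs (Fin.castSucc_le_castSucc_iff.mpr (Fin.le_last h))

lemma coeffHeight_add_le (H : RothHypotheses P r β s) (hs0 : 0 ≤ s) (hs : s ≤ 1 / 4)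
    (hsep : IsSeparation P r n U V) :
    coeffHeight U + coeffHeight V ≤ n * (coeffHeight P + 2 * r 0 * totalWeight K) := by
  have hlast : (r (Fin.last (m + 1)) : ℝ) ≤ 1 / 4 * r 0 :=
    (H.last_le hs0 (by linarith) 0).trans
      (mul_le_mul_of_nonneg_right hs (Nat.cast_nonneg _))
  have hsum : 3 / 4 * ∑ h, (r h : ℝ) ≤ r 0 :=
    le_trans (by gcongr; linarith)
      (one_sub_mul_sum_le hs0 (fun h ↦ Nat.cast_nonneg (r h)) H.ratio_le)
  have hlog : Real.log (n.factorial * (2 ^ ∑ h, r h) ^ n) ≤ n * (2 * r 0) := by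
    refine (log_factorial_mul_pow_le hsep.le _).trans ?_
    refine mul_le_mul_of_nonneg_left ?_ (Nat.cast_nonneg n)
    push_cast
    calc (r (Fin.last (m + 1)) + ∑ h, (r h : ℝ)) * Real.log 2
        ≤ (r (Fin.last (m + 1)) + ∑ h, (r h : ℝ)) * 1 := by
          gcongr
          linarith [Real.log_two_lt_d9]
      _ ≤ 2 * r 0 := by linarith [(Nat.cast_nonneg (r 0) : (0 : ℝ) ≤ r 0)]
  calc coeffHeight U + coeffHeight V ≤ _ := hsep.coeffHeight_le
    _ ≤ n * coeffHeight P + totalWeight K * (n * (2 * r 0)) := by gcongr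
    _ = n * (coeffHeight P + 2 * r 0 * totalWeight K) := by ring

lemma left (H : RothHypotheses P r β s) (hs0 : 0 ≤ s) (hs : s ≤ 1 / 4)
    (hsep : IsSeparation P r n U V) :
    RothHypotheses U (fun h ↦ n * r h.castSucc) (fun h ↦ β h.castSucc) s where
  ne_zero := hsep.left_ne_zero
  pos h := Nat.mul_pos hsep.pos (H.pos _)
  degreeOf_le := hsep.degreeOf_left_le
  ratio_le j := by
    push_cast
    rw [mul_left_comm]
    gcongr
    exact H.ratio_le j.castSucc
  height_le h := by
    have hP := H.height_le h.castSucc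
    push_cast at hP ⊢
    calc _ ≤ n * (coeffHeight P + 2 * r 0 * totalWeight K) +
          2 * (m + 1) * (n * r 0) * totalWeight K := by
          gcongr
          · linarith [H.coeffHeight_add_le hs0 hs hsep, coeffHeight_nonneg V]
          · rfl
      _ = n * (coeffHeight P + 2 * (m + 1 + 1) * r 0 * totalWeight K) := by ring
      _ ≤ n * (s * (r h.castSucc * logHeight₁ (β h.castSucc))) := by gcongr
      _ = _ := by ring

lemma exists_coeff_right_ne_zero [CharZero K] (H : RothHypotheses P r β s)
    (hT : 0 < totalWeight K) (hs0 : 0 ≤ s) (hs : s ≤ 1 / 4) (hsep : IsSeparation P r n U V) :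
    ∃ B, coeff B (translate (fun _ ↦ β (Fin.last (m + 1))) V) ≠ 0 ∧
      B 0 ≤ n * (s * r (Fin.last (m + 1))) := by
  refine exists_coeff_translate_ne_zero_le hsep.right_ne_zero (hsep.degreeOf_right_le 0)
    (H.logHeight₁_pos hT hs0 _) ?_
  have hlast : r (Fin.last (m + 1)) ≤ r 0 := H.antitone (by linarith) (Fin.zero_le _)
  have hP := H.height_le (Fin.last (m + 1))
  push_cast at hP ⊢
  calc _ ≤ n * (coeffHeight P + 2 * r 0 * totalWeight K) + n * r 0 * totalWeight K := by
        gcongr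
        linarith [H.coeffHeight_add_le hs0 hs hsep, coeffHeight_nonneg U]
    _ = n * (coeffHeight P + (2 + 1) * r 0 * totalWeight K) := by ring
    _ ≤ n * (coeffHeight P + 2 * (m + 1 + 1) * r 0 * totalWeight K) := by
        gcongr
        linarith [(Nat.cast_nonneg m : (0 : ℝ) ≤ m)]
    _ ≤ n * (s * (r (Fin.last (m + 1)) * logHeight₁ (β (Fin.last (m + 1))))) := by gcongr
    _ = _ := by ring

end

end RothHypotheses

lemma sum_max_sub_le {θ c s : ℝ} {n : ℕ} (hs : 0 ≤ s) :
    ∑ a ∈ range n, max (θ - a * c) 0 ≤ ∑ a ∈ range n, max (θ - (s + a * c)) 0 + n * s := by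
  calc _ ≤ ∑ a ∈ range n, (max (θ - (s + a * c)) 0 + s) := by
        refine Finset.sum_le_sum fun a _ ↦ ?_
        rw [← max_add_add_right]
        exact max_le_max (by linarith) (by linarith)
    _ = _ := by rw [Finset.sum_add_distrib, Finset.sum_const, card_range, nsmul_eq_mul]

lemma RothHypotheses.le_of_isSeparation {s θ η : ℝ} (hη0 : 0 < η) (hη : η ≤ 1 / 2)
    (hs0 : 0 ≤ s) (hs : s ≤ η ^ 2)
    {P : MvPolynomial (Fin (m + 1 + 1)) K} {r : Fin (m + 1 + 1) → ℕ}
    {β : Fin (m + 1 + 1) → K} {n : ℕ} {U : MvPolynomial (Fin (m + 1)) K}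
    {V : MvPolynomial (Fin 1) K} (H : RothHypotheses P r β s) (hsep : IsSeparation P r n U V)
    (hθ : WeightedOrderGE (fun h ↦ 1 / (r h : ℝ)) θ (translate β P))
    {A : Fin (m + 1) →₀ ℕ} (hA : coeff A (translate (fun h ↦ β h.castSucc) U) ≠ 0)
    (hAle : Finsupp.weight (fun h ↦ 1 / ((n * r (Fin.castSucc h) : ℕ) : ℝ)) A ≤
      2 * (m + 1) * η ^ 2)
    {B : Fin 1 →₀ ℕ} (hB : coeff B (translate (fun _ ↦ β (Fin.last (m + 1))) V) ≠ 0)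
    (hBle : B 0 ≤ n * (s * r (Fin.last (m + 1)))) : θ ≤ 2 * (m + 2) * η := by
  have hn := hsep.pos
  have hr h : (0 : ℝ) < r h := by exact_mod_cast H.pos h
  have hlast := hr (Fin.last (m + 1))
  have hn2 : n * (1 / (r (Fin.last (m + 1)) : ℝ)) ≤ 2 := by
    have : n ≤ 2 * r (Fin.last (m + 1)) := by linarith [hsep.le, H.pos (Fin.last (m + 1))]
    rw [mul_one_div, div_le_iff₀ hlast]
    exact_mod_cast this
  have hAweight : Finsupp.weight (fun h : Fin (m + 1) ↦ 1 / (r h.castSucc : ℝ)) A ≤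
      n * (2 * (m + 1) * η ^ 2) := by
    refine le_trans (le_of_eq ?_) (mul_le_mul_of_nonneg_left hAle (Nat.cast_nonneg n))
    simp only [Finsupp.weight_apply, Finsupp.sum, Finset.mul_sum, nsmul_eq_mul]
    refine Finset.sum_congr rfl fun h _ ↦ ?_
    push_cast
    field_simp
  have hBweight : B 0 * (1 / (r (Fin.last (m + 1)) : ℝ)) ≤ n * s := by
    rw [mul_one_div, div_le_iff₀ hlast]
    linarith
  have hsum := hsep.sum_max_le (c := s / r (Fin.last (m + 1))) (fun h ↦ by positivity)
    (fun h ↦ by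
      rw [div_le_div_iff₀ (hr _) hlast]
      linarith [H.last_le hs0 (by nlinarith) h]) (by positivity) hθ hA hB
  rw [mul_div_cancel₀ _ hlast.ne'] at hsum
  refine le_of_sum_max_le hη0 hη (by linarith [(Nat.cast_nonneg m : (0 : ℝ) ≤ m)])
    (one_div_pos.mpr hlast) hn hn2 ?_
  calc _ ≤ _ := sum_max_sub_le hs0
    _ ≤ n * (2 * (m + 1) * η ^ 2) + n * s + n * s := by linarith
    _ ≤ n * (2 * (m + 1) * η ^ 2) + n * η ^ 2 + n * η ^ 2 := by gcongr
    _ = _ := by ring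

theorem RothHypotheses.exists_coeff_translate_ne_zero_weight_le [CharZero K]
    (hT : 0 < totalWeight K) {η : ℝ} (hη0 : 0 < η) (hη : η ≤ 1 / 2)
    {P : MvPolynomial (Fin (m + 1)) K} {r : Fin (m + 1) → ℕ} {β : Fin (m + 1) → K}
    (H : RothHypotheses P r β (η ^ 2 ^ m)) : ∃ I, coeff I (translate β P) ≠ 0 ∧
      Finsupp.weight (fun h ↦ 1 / (r h : ℝ)) I ≤ 2 * (m + 1) * η := by
  induction m generalizing η with
  | zero =>
    have hr : (0 : ℝ) < r 0 := by exact_mod_cast H.pos 0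
    have hP := H.height_le 0
    simp only [pow_zero, pow_one] at H hP
    obtain ⟨J, hJ, hle⟩ := exists_coeff_translate_ne_zero_le (B := η * r 0) H.ne_zero
      (H.degreeOf_le 0) (H.logHeight₁_pos hT hη0.le 0) (by
        refine le_trans ?_ (hP.trans_eq (mul_assoc ..).symm)
        gcongr
        simp
        linarith)
    refine ⟨J, hJ, ?_⟩
    rw [Finsupp.weight_apply, Finsupp.sum_fintype _ _ (by simp), Fin.sum_univ_one, nsmul_eq_mul,
      mul_one_div]
    calc J 0 / (r 0 : ℝ) ≤ η := (div_le_iff₀ hr).mpr hle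
      _ ≤ _ := by simp; linarith
  | succ m ih =>
    have hs0 : 0 ≤ η ^ 2 ^ (m + 1) := by positivity
    have hsη : η ^ 2 ^ (m + 1) ≤ η ^ 2 :=
      pow_le_pow_of_le_one hη0.le (by linarith) (Nat.le_self_pow m.succ_ne_zero 2)
    have hη2 : η ^ 2 ≤ 1 / 4 := by nlinarith
    obtain ⟨n, U, V, hsep⟩ := exists_isSeparation H.ne_zero H.degreeOf_le
    have HU := H.left hs0 (hsη.trans hη2) hsep
    rw [pow_succ', pow_mul] at HU
    obtain ⟨A, hA, hAle⟩ := ih (by positivity) (by linarith) HU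
    obtain ⟨B, hB, hBle⟩ := H.exists_coeff_right_ne_zero hT hs0 (hsη.trans hη2) hsep
    obtain ⟨I, hI, hmin⟩ := exists_coeff_ne_zero_weightedOrderGE (fun h ↦ 1 / (r h : ℝ))
      ((map_ne_zero_iff _ (translate_injective β)).mpr H.ne_zero)
    refine ⟨I, hI, (H.le_of_isSeparation hη0 hη hs0 hsη hsep hmin hA hAle hB hBle).trans_eq ?_⟩
    push_cast
    ring

end Induction

/-! ### Descent to a number field -/

section Descent

open NumberField Module

variable {m : ℕ} {K : IntermediateField ℚ QBar}

lemma index_le_weight {P : MvPolynomial (Fin m) QBar} {β : Fin m → QBar} {I : Fin m →₀ ℕ}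
    (hI : coeff I (translate β P) ≠ 0) (r : Fin m → ℕ) :
    index β r P ≤ Finsupp.weight (fun h ↦ 1 / (r h : ℝ)) I := by
  refine csInf_le ⟨0, ?_⟩ ⟨I, ?_, ?_⟩
  · rintro t ⟨J, -, rfl⟩
    positivity
  · rwa [dividedDeriv_eq_hasse, Finsupp.equivFunOnFinite_symm_coe, ← coeff_translate]
  · simp [Finsupp.weight_apply, Finsupp.sum_fintype, div_eq_mul_inv]

lemma index_map_le_weight {Q : MvPolynomial (Fin m) K} {γ : Fin m → K} {I : Fin m →₀ ℕ}
    (hI : coeff I (translate γ Q) ≠ 0) (r : Fin m → ℕ) :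
    index (fun h ↦ (γ h : QBar)) r (map (algebraMap K QBar) Q) ≤
      Finsupp.weight (fun h ↦ 1 / (r h : ℝ)) I := by
  refine index_le_weight ?_ r
  have hmap := map_translate (algebraMap K QBar) γ Q
  rw [show (fun h ↦ (γ h : QBar)) = algebraMap K QBar ∘ γ from rfl, ← hmap, coeff_map]
  exact (map_ne_zero_iff _ (algebraMap K QBar).injective).mpr hI

lemma logHeight_algebraMap_eq_finrank_mul_div {F L : Type*} [Field F] [NumberField F] [Field L]
    [NumberField L] [Algebra F L] {ι : Type*} [Finite ι] (x : ι → F) :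
    logHeight (fun i ↦ algebraMap F L (x i)) = finrank ℚ L * (logHeight x / finrank ℚ F) := by
  have hF : (finrank ℚ F : ℝ) ≠ 0 := by exact_mod_cast finrank_pos.ne'
  rw [logHeight_algebraMap, ← finrank_mul_finrank ℚ F L]
  push_cast
  field_simp

variable [NumberField K]

lemma logHeight₁_eq_finrank_mul_absLogHeight₁ (x : K) :
    logHeight₁ x = finrank ℚ K * absLogHeight₁ (x : QBar) := by
  have hint : IsIntegral ℚ (x : QBar) := isIntegral_QBar _
  have : FiniteDimensional ℚ (IntermediateField.adjoin ℚ {(x : QBar)}) :=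
    IntermediateField.adjoin.finiteDimensional hint
  have : NumberField (IntermediateField.adjoin ℚ {(x : QBar)}) := {}
  have hle : IntermediateField.adjoin ℚ {(x : QBar)} ≤ K :=
    IntermediateField.adjoin_le_iff.mpr (by simp)
  let _ := (IntermediateField.inclusion hle).toRingHom.toAlgebra
  have hvec : (fun i ↦ algebraMap (IntermediateField.adjoin ℚ {(x : QBar)}) K
      (![IntermediateField.AdjoinSimple.gen ℚ (x : QBar), 1] i)) = ![x, 1] := by
    ext i
    fin_cases i
    · rfl
    · simp
  rw [logHeight₁_eq_logHeight, ← hvec, logHeight_algebraMap_eq_finrank_mul_div,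
    ← logHeight₁_eq_logHeight, absLogHeight₁, absMulHeight₁, dif_pos hint,
    Real.log_rpow (mulHeight₁_pos _), logHeight₁_eq_log_mulHeight₁, inv_mul_eq_div]

lemma coeffHeight_eq_finrank_mul_polyHeight (P : MvPolynomial (Fin m) K) :
    coeffHeight P = finrank ℚ K * polyHeight (map (algebraMap K QBar) P) := by
  set Q := map (algebraMap K QBar) P with hQ
  have hle : coeffField Q ≤ K := by
    refine IntermediateField.adjoin_le_iff.mpr fun c hc ↦ ?_
    obtain ⟨s, -, rfl⟩ := mem_coeffs_iff.mp (Finset.mem_coe.mp hc)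
    rw [hQ, coeff_map]
    exact (coeff s P).2
  let _ := (IntermediateField.inclusion hle).toRingHom.toAlgebra
  have hsupp : P.support = Q.support :=
    (support_map_of_injective P (algebraMap K QBar).injective).symm
  rw [polyHeight, ← logHeight_algebraMap_eq_finrank_mul_div (L := K), coeffHeight,
    ← logHeight_comp_equiv (Equiv.subtypeEquivRight fun s ↦ by rw [hsupp] :
      Q.support ≃ P.support)]
  congr 1

lemma exists_numberField_map_eq {σ : Type*} [Finite σ] (P : MvPolynomial σ QBar) (β : σ → QBar) :
    ∃ (K : IntermediateField ℚ QBar) (_ : NumberField K) (Q : MvPolynomial σ K) (γ : σ → K),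
      map (algebraMap K QBar) Q = P ∧ (fun h ↦ (γ h : QBar)) = β := by
  let S : Set QBar := P.coeffs ∪ Set.range β
  have : FiniteDimensional ℚ (IntermediateField.adjoin ℚ S) :=
    IntermediateField.finiteDimensional_adjoin fun x _ ↦ isIntegral_QBar x
  have hS {x : QBar} (hx : x ∈ S) : x ∈ IntermediateField.adjoin ℚ S :=
    IntermediateField.subset_adjoin ℚ S hx
  obtain ⟨Q, hQ⟩ : P ∈ Set.range (map (algebraMap (IntermediateField.adjoin ℚ S) QBar)) :=
    mem_range_map_iff_coeffs_subset.mpr fun c hc ↦ ⟨⟨c, hS (Or.inl hc)⟩, rfl⟩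
  exact ⟨IntermediateField.adjoin ℚ S, {}, Q, fun h ↦ ⟨β h, hS (Or.inr ⟨h, rfl⟩)⟩, hQ, rfl⟩

lemma rothHypotheses_of_polyHeight_le {Q : MvPolynomial (Fin (m + 1)) K} {r : Fin (m + 1) → ℕ}
    {γ : Fin (m + 1) → K} {s : ℝ} (hs : 0 ≤ s) (hQ : map (algebraMap K QBar) Q ≠ 0)
    (hr : ∀ h, 0 < r h) (hdeg : ∀ h, (map (algebraMap K QBar) Q).degreeOf h ≤ r h)
    (hratio : ∀ j : Fin m, (r j.succ : ℝ) / r j.castSucc ≤ s)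
    (hheight : polyHeight (map (algebraMap K QBar) Q) + 2 * (m + 1) * r 0 ≤
      s * ⨅ h, r h * absLogHeight₁ (γ h : QBar)) : RothHypotheses Q r γ s where
  ne_zero := fun h0 ↦ hQ (by rw [h0, map_zero])
  pos := hr
  degreeOf_le h := by
    simpa only [degreeOf_eq_sup, support_map_of_injective Q (algebraMap K QBar).injective]
      using hdeg h
  ratio_le j := (div_le_iff₀ (by exact_mod_cast hr _)).mp (hratio j)
  height_le h := by
    rw [totalWeight_eq_finrank, coeffHeight_eq_finrank_mul_polyHeight,
      logHeight₁_eq_finrank_mul_absLogHeight₁]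
    calc _ = finrank ℚ K * (polyHeight (map (algebraMap K QBar) Q) + 2 * (m + 1) * r 0) := by ring
      _ ≤ finrank ℚ K * (s * (r h * absLogHeight₁ (γ h : QBar))) := by
        gcongr
        refine hheight.trans (mul_le_mul_of_nonneg_left ?_ hs)
        exact Finite.ciInf_le (fun h ↦ r h * absLogHeight₁ (γ h : QBar)) h
      _ = _ := by ring

end Descent

end RothLemma

theorem mainTheorem5 (m : ℕ) (hm : 0 < m)
    (P : MvPolynomial (Fin m) (AlgebraicClosure ℚ)) (hP : P ≠ 0)
    (r : Fin m → ℕ) (hr : ∀ h, 0 < r h) (hdeg : ∀ h, P.degreeOf h ≤ r h)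
    (β : Fin m → AlgebraicClosure ℚ)
    (η : ℝ) (hη0 : 0 < η) (hη : η ≤ 1 / 2)
    (hratio : ∀ (j : ℕ) (hj : j + 1 < m),
      (r ⟨j + 1, hj⟩ : ℝ) / (r ⟨j, Nat.lt_of_succ_lt hj⟩ : ℝ) ≤ η ^ (2 ^ (m - 1)))
    (hheight : RothLemma.polyHeight P + 2 * (m : ℝ) * (r ⟨0, hm⟩ : ℝ) ≤
      η ^ (2 ^ (m - 1)) * ⨅ h : Fin m, (r h : ℝ) * NumberField.absLogHeight₁ (β h)) :
    RothLemma.index β r P ≤ 2 * (m : ℝ) * η := by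
  obtain ⟨m, rfl⟩ := Nat.exists_eq_add_one_of_ne_zero hm.ne'
  obtain ⟨K, _, Q, γ, rfl, rfl⟩ := RothLemma.exists_numberField_map_eq P β
  rw [Nat.add_sub_cancel] at hratio hheight
  push_cast at hheight ⊢
  have H : RothLemma.RothHypotheses Q r γ (η ^ 2 ^ m) :=
    RothLemma.rothHypotheses_of_polyHeight_le (by positivity) hP hr hdeg
      (fun j ↦ hratio j (Nat.succ_lt_succ j.2)) hheight
  obtain ⟨I, hI, hweight⟩ :=
    H.exists_coeff_translate_ne_zero_weight_le (NumberField.totalWeight_pos K) hη0 hη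
  exact (RothLemma.index_map_le_weight hI r).trans hweight
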